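/- Let $K\ge 2$ and $L\ge 1$ be integers and let $\Lambda$ be the $2K\times 3L$ triangular grid with periodic boundary conditions: its $N=6KL$ sites are the pairs $(i,j)\in\mathbb Z/2K\times\mathbb Z/6L$ with $i+j$ even ($i$ is the row, $j$ the column), and the six neighbors of $(i,j)$ are $(i,j\pm2)$ and $(i\pm1,j\pm1)$. Let $\mathcal X$ be the set of hard-core configurations on $\Lambda$, i.e. of all $\sigma\in\{0,1\}^{\Lambda}$ with $\sigma(v)\sigma(w)=0$ for all neighboring sites $v,w$, and let $H(\sigma)=-\sum_{v\in\Lambda}\sigma(v)$. Let $Q(\sigma,\sigma')=\frac1N$ if $\sigma,\sigma'\in\mathcal X$ differ in exactly one site, $Q(\sigma,\sigma')=0$ if they differ in more than one site, and $Q(\sigma,\sigma)=1-\sum_{\eta\ne\sigma}Q(\sigma,\eta)$. Let $\mathbf a,\mathbf b,\mathbf c\in\mathcal X$ be the configurations whose occupied sites are exactly those in the columns $j\equiv 0$, $j\equiv 1$, $j\equiv 2\pmod 3$, respectively. A path $\omega:\sigma\to\sigma'$ is a finite sequence $\omega_1=\sigma,\dots,\omega_n=\sigma'$ in $\mathcal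 X$ with $Q(\omega_i,\omega_{i+1})>0$ for $1\le i<n$. Put $\Phi(\sigma,\sigma')=\min_{\omega:\sigma\to\sigma'}\max_i H(\omega_i)$, and $\Phi(\sigma,A)=\min_{\sigma'\in A}\Phi(\sigma,\sigma')$ for non-empty $A\subset\mathcal X$. Then: (i) The set of global minima of $H$ on $\mathcal X$ (the maximum-occupancy configurations) is $\{\mathbf a,\mathbf b,\mathbf c\}$. (ii) $\Phi(\mathbf a,\mathbf b)-H(\mathbf a)=\Phi(\mathbf a,\mathbf c)-H(\mathbf a)=\Phi(\mathbf b,\mathbf c)-H(\mathbf b)=\min\{K,2L\}+1$. (iii) $\Phi(\sigma,\{\mathbf a,\mathbf b,\mathbf c\})-H(\sigma)\le\min\{K,2L\}$ for every $\sigma\in\mathcal X\setminus\{\mathbf a,\mathbf b,\mathbf c\}$. -/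

import Mathlib

/-- An energy landscape on a configuration space `X`: an energy function `H`
and a connectivity function `Q`. -/
structure EnergyLandscape (X : Type*) where
  /-- the energy function (Hamiltonian) -/
  H : X → ℝ
  /-- the connectivity function -/
  Q : X → X → ℝ

namespace EnergyLandscape

variable {X : Type*} (E : EnergyLandscape X)

/-- The stable configurations: the global minima of the energy. -/
def stable : Set X := {σ | ∀ η, E.H σ ≤ E.H η}

/-- A path from `σ` to `σ'`: a finite non-empty sequence of configurations that starts in `σ`,
ends in `σ'`, and whose consecutive members `x, y` satisfy `Q x y > 0`. -/
structure Path (σ σ' : X) where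
  /-- the number of moves -/
  length : ℕ
  /-- the visited configurations -/
  point : Fin (length + 1) → X
  source : point 0 = σ
  target : point (Fin.last length) = σ'
  step : ∀ i : Fin length, 0 < E.Q (point i.castSucc) (point i.succ)

variable {E} in
/-- The height of a path: the largest energy along it. -/
noncomputable def Path.height {σ σ' : X} (ω : E.Path σ σ') : ℝ :=
  Finset.univ.sup' Finset.univ_nonempty fun i => E.H (ω.point i)

/-- The communication height between two configurations: the least height of a path
from `σ` to `σ'`. -/
noncomputable def commHeight (σ σ' : X) : ℝ :=
  sInf (Set.range fun ω : E.Path σ σ' => ω.height)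

/-- The communication height between two sets of configurations. -/
noncomputable def commHeightSet (A B : Set X) : ℝ :=
  sInf (Set.image2 E.commHeight A B)

/-- On a finite configuration space the infimum in `commHeight` is a minimum as soon as
there is a path. -/
theorem isLeast_commHeight [Finite X] {σ σ' : X} (h : Nonempty (E.Path σ σ')) :
    IsLeast (Set.range fun ω : E.Path σ σ' => ω.height) (E.commHeight σ σ') := by
  have hfin : (Set.range fun ω : E.Path σ σ' => ω.height).Finite := by
    refine (Set.finite_range E.H).subset ?_
    rintro _ ⟨ω, rfl⟩
    obtain ⟨i, -, hi⟩ := Finset.exists_mem_eq_sup' (Finset.univ_nonempty)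
      (fun i => E.H (ω.point i))
    exact ⟨ω.point i, hi.symm⟩
  exact ⟨(Set.range_nonempty _).csInf_mem hfin, fun x hx => csInf_le hfin.bddBelow hx⟩

/-- On a finite configuration space the infimum in `commHeightSet` is a minimum if both
sets are non-empty. -/
theorem isLeast_commHeightSet [Finite X] {A B : Set X} (hA : A.Nonempty) (hB : B.Nonempty) :
    IsLeast (Set.image2 E.commHeight A B) (E.commHeightSet A B) := by
  have hfin : (Set.image2 E.commHeight A B).Finite :=
    Set.Finite.image2 _ A.toFinite B.toFinite
  exact ⟨(hA.image2 hB).csInf_mem hfin, fun x hx => csInf_le hfin.bddBelow hx⟩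

theorem nonempty_path {σ σ' : X} (h : Relation.ReflTransGen (fun x y => 0 < E.Q x y) σ σ') :
    Nonempty (E.Path σ σ') := by
  induction h using Relation.ReflTransGen.head_induction_on with
  | refl => exact ⟨⟨0, fun _ => σ', rfl, rfl, fun i => i.elim0⟩⟩
  | @head x y hxy _ ih =>
    obtain ⟨n, f, h0, h1, hs⟩ := ih
    refine ⟨⟨n + 1, Fin.cons x f, rfl, ?_, ?_⟩⟩
    · rw [← Fin.succ_last, Fin.cons_succ, h1]
    · intro i
      refine Fin.cases ?_ (fun j => ?_) i
      · rw [Fin.castSucc_zero, Fin.cons_zero, Fin.cons_succ, h0]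
        exact hxy
      · rw [← Fin.succ_castSucc, Fin.cons_succ, Fin.cons_succ]
        exact hs j

end EnergyLandscape

namespace TriangularGrid

/-- The sites of the `2K × 3L` triangular grid with periodic boundary conditions. A site has
coordinates `(i, j)`, where `i` is its row (out of `2K`, modulo `2K`) and `j` its column
(out of `6L`, modulo `6L`). Columns are half a lattice spacing apart, so that a row contains
only the columns of its own parity: `3L` sites in each row, `K` sites in each column. -/
abbrev Site (K L : ℕ) : Type :=
  {p : ZMod (2 * K) × ZMod (6 * L) // Even (p.1.val + p.2.val)}

/-- The triangular grid as a graph: the six neighbours of `(i, j)` are `(i, j ± 2)` in its own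
row and `(i ± 1, j ± 1)` in the two adjacent rows. -/
def grid (K L : ℕ) : SimpleGraph (Site K L) :=
  SimpleGraph.fromRel fun v w =>
    w.1 = v.1 + (0, 2) ∨ w.1 = v.1 + (1, 1) ∨ w.1 = v.1 + (1, -1)

/-- The hard-core configurations on the triangular grid. -/
abbrev Config (K L : ℕ) : Type :=
  {σ : Site K L → Fin 2 // ∀ v w, (grid K L).Adj v w → σ v * σ w = 0}

noncomputable instance (K L : ℕ) [NeZero K] [NeZero L] : Fintype (Config K L) :=
  Fintype.ofFinite _

variable {K L : ℕ}

/-- The colour (the component of the tripartition) of a site: the residue of its column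
modulo `3`. -/
def colour (v : Site K L) : ZMod 3 :=
  ZMod.castHom (Dvd.dvd.mul_right (by norm_num) L : 3 ∣ 6 * L) (ZMod 3) v.1.2

/-- Neighbouring sites have different colours. -/
theorem colour_ne_of_adj {v w : Site K L} (h : (grid K L).Adj v w) : colour v ≠ colour w := by
  have key : ∀ v w : Site K L,
      (w.1 = v.1 + (0, 2) ∨ w.1 = v.1 + (1, 1) ∨ w.1 = v.1 + (1, -1)) →
      colour v ≠ colour w := by
    intro v w h
    have h3 : colour w = colour v + 2 ∨ colour w = colour v + 1 ∨ colour w = colour v + -1 := by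
      unfold colour
      rcases h with h | h | h
      · left
        rw [h, Prod.snd_add, map_add, map_ofNat]
      · right; left
        rw [h, Prod.snd_add, map_add, map_one]
      · right; right
        rw [h, Prod.snd_add, map_add, map_neg, map_one]
    generalize colour v = x at *
    generalize colour w = y at *
    revert x y
    decide
  rcases ((SimpleGraph.fromRel_adj _ _ _).1 h).2 with h | h
  · exact key v w h
  · exact (key w v h).symm

/-- The configuration in which exactly the sites of colour `k` are occupied. -/
def monochromatic (K L : ℕ) (k : ZMod 3) : Config K L :=
  ⟨fun v => if colour v = k then 1 else 0, by
    intro v w h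
    have := colour_ne_of_adj h
    by_cases hv : colour v = k
    · have hw : colour w ≠ k := fun hw => this (hv.trans hw.symm)
      simp [hw]
    · simp [hv]⟩

/-- The configuration **a**: the occupied columns are `0, 3, 6, …`. -/
def configA (K L : ℕ) : Config K L := monochromatic K L 0

/-- The configuration **b**: the occupied columns are `1, 4, 7, …`. -/
def configB (K L : ℕ) : Config K L := monochromatic K L 1

/-- The configuration **c**: the occupied columns are `2, 5, 8, …`. -/
def configC (K L : ℕ) : Config K L := monochromatic K L 2

section

variable [NeZero K] [NeZero L]

/-- The energy of a configuration: minus its number of particles. -/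
noncomputable def energy (σ : Config K L) : ℝ := -∑ v : Site K L, ((σ.1 v : ℕ) : ℝ)

/-- The number of sites in which two configurations differ. -/
def distance (σ σ' : Config K L) : ℕ :=
  (Finset.univ.filter fun v : Site K L => σ.1 v ≠ σ'.1 v).card

/-- The connectivity function for two different configurations: `1 / N` if they differ
in exactly one of the `N` sites, and `0` if they differ in more. -/
noncomputable def moveWeight (σ σ' : Config K L) : ℝ :=
  if distance σ σ' = 1 then 1 / (Fintype.card (Site K L) : ℝ) else 0

open Classical in
/-- The connectivity function of the single-site dynamics. -/
noncomputable def connectivity (σ σ' : Config K L) : ℝ :=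
  if σ = σ' then 1 - ∑ η ∈ Finset.univ.filter (fun η => η ≠ σ), moveWeight σ η
  else moveWeight σ σ'

end

/-- The energy landscape of the hard-core dynamics on the `2K × 3L` triangular grid. -/
noncomputable def landscape (K L : ℕ) [NeZero K] [NeZero L] : EnergyLandscape (Config K L) where
  H := energy
  Q := connectivity

section

variable [NeZero K] [NeZero L]

theorem distance_comm (σ σ' : Config K L) : distance σ σ' = distance σ' σ := by
  unfold distance
  congr 1
  ext v
  simp [ne_comm]

theorem connectivity_pos {σ σ' : Config K L} (h : distance σ σ' = 1) :
    0 < connectivity σ σ' := by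
  have hne : σ ≠ σ' := by
    rintro rfl
    simp [distance] at h
  have hcard : 0 < Fintype.card (Site K L) := by
    obtain ⟨v, -⟩ := Finset.card_pos.1 (h ▸ Nat.one_pos)
    exact Fintype.card_pos_iff.2 ⟨v⟩
  rw [connectivity, if_neg hne, moveWeight, if_pos h]
  positivity

/-- The connectivity function is irreducible: any two configurations are joined by a path. -/
theorem exists_path (σ σ' : Config K L) : Nonempty ((landscape K L).Path σ σ') := by
  let R : Config K L → Config K L → Prop := fun x y => 0 < connectivity x y
  let z : Config K L := ⟨fun _ => 0, fun _ _ _ => rfl⟩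
  have key : ∀ n : ℕ, ∀ η : Config K L, distance η z = n →
      Relation.ReflTransGen R η z ∧ Relation.ReflTransGen R z η := by
    intro n
    induction n with
    | zero =>
      intro η h
      have : η = z := by
        apply Subtype.ext
        funext v
        by_contra hv
        have h0 := Finset.card_eq_zero.1 h
        have hm : v ∈ Finset.univ.filter fun u : Site K L => η.1 u ≠ z.1 u :=
          Finset.mem_filter.2 ⟨Finset.mem_univ v, hv⟩
        rw [h0] at hm
        exact Finset.notMem_empty v hm
      subst this
      exact ⟨.refl, .refl⟩
    | succ n ih =>
      intro η h
      obtain ⟨v, hv⟩ := Finset.card_pos.1 (show 0 < (Finset.univ.filter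
        fun v : Site K L => η.1 v ≠ z.1 v).card by
          have : (Finset.univ.filter fun v : Site K L => η.1 v ≠ z.1 v).card = n + 1 := h
          omega)
      have hv' := (Finset.mem_filter.1 hv).2
      let ξ : Config K L := ⟨Function.update η.1 v 0, by
        intro u w huw
        by_cases hu : u = v
        · simp [hu]
        · by_cases hw : w = v
          · simp [hw]
          · simpa [hu, hw] using η.2 u w huw⟩
      have hξ : distance ξ z = n := by
        have : (Finset.univ.filter fun u : Site K L => ξ.1 u ≠ z.1 u) =
            (Finset.univ.filter fun u : Site K L => η.1 u ≠ z.1 u).erase v := by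
          ext u
          by_cases hu : u = v
          · simp [hu, ξ, z]
          · simp [hu, ξ, z]
        have h' : (Finset.univ.filter fun u : Site K L => η.1 u ≠ z.1 u).card = n + 1 := h
        unfold distance
        rw [this, Finset.card_erase_of_mem hv, h']
        rfl
      have hd : distance η ξ = 1 := by
        unfold distance
        rw [Finset.card_eq_one]
        refine ⟨v, ?_⟩
        ext u
        by_cases hu : u = v
        · subst hu
          simpa [ξ, z] using hv'
        · simp [hu, ξ]
      obtain ⟨h1, h2⟩ := ih ξ hξ
      exact ⟨.head (connectivity_pos hd) h1,
        .tail h2 (connectivity_pos (distance_comm η ξ ▸ hd))⟩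
  exact (landscape K L).nonempty_path ((key _ σ rfl).1.trans (key _ σ' rfl).2)

end

end TriangularGrid

open TriangularGrid

/-!
A double row of the grid is a cycle of `6L` columns in which particles have distance at least `3`,
so it holds at most `2L` particles; if it holds `2L`, every window of three consecutive columns
contains exactly one particle and all of them have the same colour (`exists_fullRow`). Three
consecutive columns form a cycle of `2K` layers, no two consecutive ones of which are both occupied,
so they hold at most `K` particles; if they hold `K`, the middle column is either fully occupied or
empty (`pairOcc_mid_const`). Both bounds count the triangles of a strip, each of which contains at
most one particle. A full double row and a full triple column have to agree where they cross. This
determines the ground states, and shows that all full double rows of a configuration that lacks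
fewer than `m = min K 2L` particles have the same colour, where there is at least one of them.

For the lower bound on the barrier, this dominant colour is shown to be constant along any path on
which at most `m` particles are missing. It could only change by removing a particle from a
configuration that lacks `m - 1` particles and adding one elsewhere. `Covers.colour_unique` excludes
this: the configuration `η` in between would have exactly one particle missing in each double row
and in each triple column of the relevant colour, so that either completion of `η` is full along
a cross of lines through the added site, and the two crosses contradict each other.

For the upper bounds, a site of colour `k` is occupied after removing its occupied neighbours.
Once a double row is cleared, colour `k` can invade the grid row by row, removing at most one
particle before each insertion (`reach_of_rowOnly`), so the cost is one more than the number of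
particles in the double row: `2L + 1` for a ground state and at most `2L` if the double row was not full.
Columns are similar (`reach_of_colEmpty`), with the difference that a site may have two occupied
neighbours ahead of it. This happens only at the first site of a column next to a full column. From
one ground state to the next this does not occur if the direction of the sweep suits the colours.
A configuration with a full column which is not a ground state can be swept from this column
without clearing anything, so that a cost of `2 ≤ K` is affordable.
-/

namespace TriangularGrid

set_option linter.unusedSectionVars false

/-! ### Parity, colour and adjacency -/

section

variable {K L : ℕ}

/-- The parity of a row; it is well defined because the number of rows is even. -/
def rowParity (K : ℕ) : ZMod (2 * K) →+* ZMod 2 :=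
  ZMod.castHom (Dvd.intro K rfl) (ZMod 2)

/-- The parity of a column; it is well defined because the number of columns is even. -/
def colParity (L : ℕ) : ZMod (6 * L) →+* ZMod 2 :=
  ZMod.castHom (Dvd.dvd.mul_right (by norm_num) L) (ZMod 2)

/-- The colour of a column, that is, its residue modulo `3`. -/
def colColour (L : ℕ) : ZMod (6 * L) →+* ZMod 3 :=
  ZMod.castHom (Dvd.dvd.mul_right (by norm_num) L) (ZMod 3)

theorem colour_eq (v : Site K L) : colour v = colColour L v.1.2 := rfl

theorem even_val_add_iff [NeZero K] [NeZero L] (i : ZMod (2 * K)) (j : ZMod (6 * L)) :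
    Even (i.val + j.val) ↔ rowParity K i = colParity L j := by
  rw [← ZMod.natCast_eq_zero_iff_even]
  push_cast
  rw [ZMod.natCast_val, ZMod.natCast_val, rowParity, colParity, ZMod.castHom_apply,
    ZMod.castHom_apply]
  generalize (i.cast : ZMod 2) = x
  generalize (j.cast : ZMod 2) = y
  revert x y
  decide

theorem Site.parity [NeZero K] [NeZero L] (v : Site K L) :
    rowParity K v.1.1 = colParity L v.1.2 :=
  (even_val_add_iff _ _).1 v.2

theorem adj_of_sub {v w : Site K L}
    (h : w.1 = v.1 + (0, 2) ∨ w.1 = v.1 + (1, 1) ∨ w.1 = v.1 + (1, -1)) :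
    (grid K L).Adj v w := by
  refine (SimpleGraph.fromRel_adj _ _ _).2 ⟨?_, Or.inl h⟩
  rintro rfl
  have key : colColour L 2 = 0 ∨ colColour L 1 = 0 ∨ colColour L (-1) = 0 := by
    rcases h with h | h | h
    · left
      rw [show (2 : ZMod (6 * L)) = 0 by simpa using congrArg Prod.snd h, map_zero]
    · right; left
      rw [show (1 : ZMod (6 * L)) = 0 by simpa using congrArg Prod.snd h, map_zero]
    · right; right
      rw [show (-1 : ZMod (6 * L)) = 0 by simpa using congrArg Prod.snd h, map_zero]
  simp only [map_ofNat, map_one, map_neg] at key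
  revert key
  decide

theorem adj_cases {v w : Site K L} (h : (grid K L).Adj v w) :
    (w.1 = v.1 + (0, 2) ∨ w.1 = v.1 + (1, 1) ∨ w.1 = v.1 + (1, -1)) ∨
      (v.1 = w.1 + (0, 2) ∨ v.1 = w.1 + (1, 1) ∨ v.1 = w.1 + (1, -1)) :=
  ((SimpleGraph.fromRel_adj _ _ _).1 h).2

theorem eq_one_of_ne_zero {x : Fin 2} (h : x ≠ 0) : x = 1 := by omega

theorem Config.not_adj (σ : Config K L) {v w : Site K L} (hv : σ.1 v = 1) (hw : σ.1 w = 1) :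
    ¬ (grid K L).Adj v w := fun h => by
  have := σ.2 v w h
  rw [hv, hw] at this
  exact absurd this (by decide)

/-- The occupation number at row `i` and column `j`, extended by zero to the pairs `(i, j)`
of odd parity, which are not sites. -/
def occ (σ : Config K L) (i : ZMod (2 * K)) (j : ZMod (6 * L)) : ℕ :=
  if h : Even (i.val + j.val) then (σ.1 ⟨(i, j), h⟩ : ℕ) else 0

theorem occ_site (σ : Config K L) (v : Site K L) : occ σ v.1.1 v.1.2 = (σ.1 v : ℕ) :=
  dif_pos v.2

theorem occ_le_one (σ : Config K L) (i : ZMod (2 * K)) (j : ZMod (6 * L)) : occ σ i j ≤ 1 := by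
  unfold occ
  split_ifs
  · omega
  · omega

theorem occ_mul_occ (σ : Config K L) (i i' : ZMod (2 * K)) (j j' : ZMod (6 * L))
    (h : (i', j') = (i, j) + (0, 2) ∨ (i', j') = (i, j) + (1, 1) ∨ (i', j') = (i, j) + (1, -1)) :
    occ σ i j * occ σ i' j' = 0 := by
  unfold occ
  split_ifs with h1 h2
  · have := σ.2 ⟨(i, j), h1⟩ ⟨(i', j'), h2⟩ (adj_of_sub h)
    generalize σ.1 ⟨(i, j), h1⟩ = x at *
    generalize σ.1 ⟨(i', j'), h2⟩ = y at *
    revert x y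
    decide
  all_goals simp

theorem config_ext {σ τ : Config K L} (h : ∀ v, σ.1 v = 1 ↔ τ.1 v = 1) : σ = τ := by
  apply Subtype.ext
  funext v
  have := h v
  generalize σ.1 v = x at *
  generalize τ.1 v = y at *
  revert x y
  decide

theorem zmod_two_cases (x y : ZMod 2) :
    (x = y ∧ x + 1 ≠ y ∧ x ≠ y + 1) ∨ (x ≠ y ∧ x + 1 = y ∧ x = y + 1) := by
  revert x y
  decide

theorem colParity_two : colParity L 2 = 0 := by
  rw [map_ofNat]
  decide

theorem monochromatic_apply (k : ZMod 3) (v : Site K L) :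
    (monochromatic K L k).1 v = 1 ↔ colour v = k := by
  simp [monochromatic]

end

/-! ### Occupation numbers of triangles, double rows and triple columns -/

section

variable {K L : ℕ} [NeZero K] [NeZero L]

theorem occ_eq_zero (σ : Config K L) {i : ZMod (2 * K)} {j : ZMod (6 * L)}
    (h : rowParity K i ≠ colParity L j) : occ σ i j = 0 :=
  dif_neg fun h' => h ((even_val_add_iff i j).1 h')

/-- The number of particles. -/
def count (σ : Config K L) : ℕ := ∑ v : Site K L, (σ.1 v : ℕ)

theorem energy_eq (σ : Config K L) : energy σ = -(count σ : ℝ) := by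
  simp [energy, count]

theorem count_eq_sum_occ (σ : Config K L) : count σ = ∑ i, ∑ j, occ σ i j := by
  rw [← Fintype.sum_prod_type', count]
  rw [← Finset.sum_filter_add_sum_filter_not Finset.univ
    (fun p : ZMod (2 * K) × ZMod (6 * L) => Even (p.1.val + p.2.val))]
  rw [Finset.sum_eq_zero (s := Finset.univ.filter fun p : ZMod (2 * K) × ZMod (6 * L) =>
    ¬ Even (p.1.val + p.2.val)), add_zero]
  · refine Finset.sum_bij (fun v _ => v.1) ?_ ?_ ?_ ?_
    · intro v _
      simpa using v.2
    · intro v _ w _ h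
      exact Subtype.ext h
    · intro p hp
      exact ⟨⟨p, (Finset.mem_filter.1 hp).2⟩, Finset.mem_univ _, rfl⟩
    · intro v _
      exact (occ_site σ v).symm
  · intro p hp
    exact dif_neg (Finset.mem_filter.1 hp).2

/-- The number of particles in column `j` of the rows `i` and `i + 1`. Exactly one of the two
places is a site. -/
def pairOcc (σ : Config K L) (i : ZMod (2 * K)) (j : ZMod (6 * L)) : ℕ :=
  occ σ i j + occ σ (i + 1) j

/-- The number of particles in columns `j`, `j + 1`, `j + 2` of rows `i` and `i + 1`. The three
sites among these places form a triangle of the grid. -/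
def triangleOcc (σ : Config K L) (i : ZMod (2 * K)) (j : ZMod (6 * L)) : ℕ :=
  pairOcc σ i j + pairOcc σ i (j + 1) + pairOcc σ i (j + 2)

theorem triangleOcc_le_one (σ : Config K L) (i : ZMod (2 * K)) (j : ZMod (6 * L)) :
    triangleOcc σ i j ≤ 1 := by
  have b := occ_le_one σ
  unfold triangleOcc pairOcc
  rcases zmod_two_cases (rowParity K i) (colParity L j) with ⟨h1, h2, h3⟩ | ⟨h1, h2, h3⟩
  · rw [occ_eq_zero σ (i := i + 1) (j := j) (by simpa using h2),
      occ_eq_zero σ (i := i) (j := j + 1) (by simpa using h3),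
      occ_eq_zero σ (i := i + 1) (j := j + 2) (by simpa [colParity_two] using h2)]
    have e1 := occ_mul_occ σ i (i + 1) j (j + 1) (by simp)
    have e2 := occ_mul_occ σ i i j (j + 2) (by simp)
    have e3 := occ_mul_occ σ i (i + 1) (j + 2) (j + 1)
      (by right; right; ext <;> simp; ring)
    have b1 := b i j
    have b2 := b (i + 1) (j + 1)
    have b3 := b i (j + 2)
    simp only [mul_eq_zero] at e1 e2 e3
    omega
  · rw [occ_eq_zero σ (i := i) (j := j) h1,
      occ_eq_zero σ (i := i + 1) (j := j + 1) (by simpa using h1),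
      occ_eq_zero σ (i := i) (j := j + 2) (by simpa [colParity_two] using h1)]
    have e1 := occ_mul_occ σ i (i + 1) (j + 1) j (by right; right; ext <;> simp)
    have e2 := occ_mul_occ σ (i + 1) (i + 1) j (j + 2) (by simp)
    have e3 := occ_mul_occ σ i (i + 1) (j + 1) (j + 2)
      (by right; left; ext <;> simp; ring)
    have b1 := b (i + 1) j
    have b2 := b i (j + 1)
    have b3 := b (i + 1) (j + 2)
    simp only [mul_eq_zero] at e1 e2 e3
    omega

/-- Summing a function on the columns over windows of three consecutive columns that start in
the columns of one colour counts every column once. -/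
theorem sum_windows (f : ZMod (6 * L) → ℕ) (s : ZMod 3) :
    ∑ j with colColour L j = s, (f j + f (j + 1) + f (j + 2)) = ∑ j, f j := by
  have shift : ∀ (a : ZMod (6 * L)),
      ∑ j with colColour L j = s, f (j + a) = ∑ j with colColour L j = s + colColour L a, f j := by
    intro a
    rw [Finset.sum_filter, Finset.sum_filter, ← Equiv.sum_comp (Equiv.addRight a)
      (fun j => if colColour L j = s + colColour L a then f j else 0)]
    simp
  rw [Finset.sum_add_distrib, Finset.sum_add_distrib, shift 1, shift 2, Finset.sum_filter,
    Finset.sum_filter, Finset.sum_filter, ← Finset.sum_add_distrib, ← Finset.sum_add_distrib]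
  refine Finset.sum_congr rfl fun j _ => ?_
  rw [map_one, map_ofNat]
  generalize colColour L j = x
  have : ∀ x s : ZMod 3, (x = s ∧ x ≠ s + 1 ∧ x ≠ s + 2) ∨ (x ≠ s ∧ x = s + 1 ∧ x ≠ s + 2) ∨
      (x ≠ s ∧ x ≠ s + 1 ∧ x = s + 2) := by decide
  rcases this x s with ⟨h1, h2, h3⟩ | ⟨h1, h2, h3⟩ | ⟨h1, h2, h3⟩
  · rw [if_pos h1, if_neg h2, if_neg h3, add_zero, add_zero]
  · rw [if_neg h1, if_pos h2, if_neg h3, zero_add, add_zero]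
  · rw [if_neg h1, if_neg h2, if_pos h3, zero_add, zero_add]

theorem card_colour (s : ZMod 3) :
    (Finset.univ.filter fun j => colColour L j = s).card = 2 * L := by
  have h := sum_windows (L := L) (fun _ => 1) s
  simp only [Finset.sum_const, Finset.card_univ, ZMod.card, smul_eq_mul] at h
  omega

/-- The number of particles in the double row `{i, i + 1}`. -/
def rowSum (σ : Config K L) (i : ZMod (2 * K)) : ℕ := ∑ j, pairOcc σ i j

/-- The number of particles in the triple column `{j, j + 1, j + 2}`. -/
def colSum (σ : Config K L) (j : ZMod (6 * L)) : ℕ :=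
  ∑ i, (occ σ i j + occ σ i (j + 1) + occ σ i (j + 2))

theorem sum_triangleOcc_row (σ : Config K L) (i : ZMod (2 * K)) :
    ∑ j, triangleOcc σ i j = 3 * rowSum σ i := by
  have shift : ∀ a : ZMod (6 * L), ∑ j, pairOcc σ i (j + a) = rowSum σ i := fun a =>
    Equiv.sum_comp (Equiv.addRight a) (pairOcc σ i)
  unfold triangleOcc
  rw [Finset.sum_add_distrib, Finset.sum_add_distrib, shift, shift, rowSum]
  ring

theorem sum_triangleOcc_col (σ : Config K L) (j : ZMod (6 * L)) :
    ∑ i, triangleOcc σ i j = 2 * colSum σ j := by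
  have shift : ∑ i, (occ σ (i + 1) j + occ σ (i + 1) (j + 1) + occ σ (i + 1) (j + 2)) =
      colSum σ j :=
    Equiv.sum_comp (Equiv.addRight 1)
      (fun i => occ σ i j + occ σ i (j + 1) + occ σ i (j + 2))
  have e : 2 * colSum σ j = colSum σ j +
      ∑ i, (occ σ (i + 1) j + occ σ (i + 1) (j + 1) + occ σ (i + 1) (j + 2)) := by
    rw [shift, two_mul]
  rw [e, colSum, ← Finset.sum_add_distrib]
  refine Finset.sum_congr rfl fun i _ => ?_
  unfold triangleOcc pairOcc
  ring

theorem sum_rowSum (σ : Config K L) : ∑ i, rowSum σ i = 2 * count σ := by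
  have shift : ∑ i, ∑ j, occ σ (i + 1) j = count σ := by
    rw [count_eq_sum_occ]
    exact Equiv.sum_comp (Equiv.addRight 1) (fun i => ∑ j, occ σ i j)
  unfold rowSum pairOcc
  simp only [Finset.sum_add_distrib]
  rw [shift, ← count_eq_sum_occ]
  ring

theorem sum_colSum (σ : Config K L) (s : ZMod 3) :
    ∑ j with colColour L j = s, colSum σ j = count σ := by
  have h := sum_windows (L := L) (fun j => ∑ i, occ σ i j) s
  rw [Finset.sum_comm, ← count_eq_sum_occ] at h
  rw [← h]
  refine Finset.sum_congr rfl fun j _ => ?_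
  simp only [colSum, Finset.sum_add_distrib]

theorem rowSum_le (σ : Config K L) (i : ZMod (2 * K)) : rowSum σ i ≤ 2 * L := by
  have h : ∑ j, triangleOcc σ i j ≤ ∑ _j : ZMod (6 * L), 1 :=
    Finset.sum_le_sum fun j _ => triangleOcc_le_one σ i j
  rw [sum_triangleOcc_row] at h
  simp only [Finset.sum_const, Finset.card_univ, ZMod.card, smul_eq_mul] at h
  omega

theorem colSum_le (σ : Config K L) (j : ZMod (6 * L)) : colSum σ j ≤ K := by
  have h : ∑ i, triangleOcc σ i j ≤ ∑ _i : ZMod (2 * K), 1 :=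
    Finset.sum_le_sum fun i _ => triangleOcc_le_one σ i j
  rw [sum_triangleOcc_col] at h
  simp only [Finset.sum_const, Finset.card_univ, ZMod.card, smul_eq_mul] at h
  omega

theorem rowSum_eq_iff (σ : Config K L) (i : ZMod (2 * K)) :
    rowSum σ i = 2 * L ↔ ∀ j, triangleOcc σ i j = 1 := by
  have h := Finset.sum_eq_sum_iff_of_le (s := Finset.univ)
    (fun j (_ : j ∈ Finset.univ) => triangleOcc_le_one σ i j)
  rw [sum_triangleOcc_row] at h
  simp only [Finset.sum_const, Finset.card_univ, ZMod.card, smul_eq_mul, Finset.mem_univ,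
    forall_const] at h
  rw [← h]
  omega

theorem colSum_eq_iff (σ : Config K L) (j : ZMod (6 * L)) :
    colSum σ j = K ↔ ∀ i, triangleOcc σ i j = 1 := by
  have h := Finset.sum_eq_sum_iff_of_le (s := Finset.univ)
    (fun i (_ : i ∈ Finset.univ) => triangleOcc_le_one σ i j)
  rw [sum_triangleOcc_col] at h
  simp only [Finset.sum_const, Finset.card_univ, ZMod.card, smul_eq_mul, Finset.mem_univ,
    forall_const] at h
  rw [← h]
  omega

theorem count_le (σ : Config K L) : count σ ≤ 2 * K * L := by
  have h : ∑ i, rowSum σ i ≤ ∑ _i : ZMod (2 * K), 2 * L :=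
    Finset.sum_le_sum fun i _ => rowSum_le σ i
  rw [sum_rowSum] at h
  simp only [Finset.sum_const, Finset.card_univ, ZMod.card, smul_eq_mul] at h
  nlinarith

/-! ### Full double rows, full triple columns and the ground states -/

/-- The double row `{i, i + 1}` is full and its particles have colour `k`. -/
def FullRow (σ : Config K L) (i : ZMod (2 * K)) (k : ZMod 3) : Prop :=
  ∀ j, pairOcc σ i j = if colColour L j = k then 1 else 0

theorem exists_colColour (k : ZMod 3) : ∃ j, colColour L j = k := by
  have h : 0 < (Finset.univ.filter fun j => colColour L j = k).card := by
    rw [card_colour]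
    have := NeZero.pos L
    omega
  obtain ⟨j, hj⟩ := Finset.card_pos.1 h
  exact ⟨j, (Finset.mem_filter.1 hj).2⟩

/-- Every window of three consecutive columns of a double row with the maximal number of particles
contains exactly one particle, so the pattern of the double row has period `3`. -/
theorem exists_fullRow (σ : Config K L) {i : ZMod (2 * K)} (h : rowSum σ i = 2 * L) :
    ∃ k, FullRow σ i k := by
  rw [rowSum_eq_iff] at h
  have per : ∀ j, pairOcc σ i (j + 3) = pairOcc σ i j := by
    intro j
    have h1 := h j
    have h2 := h (j + 1)
    unfold triangleOcc at h1 h2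
    rw [show j + 1 + 1 = j + 2 by ring, show j + 1 + 2 = j + 3 by ring] at h2
    omega
  have per' : ∀ (n : ℕ) j, pairOcc σ i (j + 3 * n) = pairOcc σ i j := by
    intro n
    induction n with
    | zero => simp
    | succ n ih =>
      intro j
      rw [show j + 3 * ((n + 1 : ℕ) : ZMod (6 * L)) = (j + 3 * n) + 3 by push_cast; ring, per, ih]
  have same : ∀ j j', colColour L j = colColour L j' → pairOcc σ i j = pairOcc σ i j' := by
    intro j j' hjj
    have h0 : colColour L (j - j') = 0 := by rw [map_sub, hjj, sub_self]
    rw [colColour, ZMod.castHom_apply, ← ZMod.natCast_val, ZMod.natCast_eq_zero_iff] at h0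
    obtain ⟨n, hn⟩ := h0
    have : j = j' + 3 * n := by
      have := ZMod.natCast_zmod_val (j - j')
      rw [hn] at this
      push_cast at this
      rw [this]
      ring
    rw [this, per']
  have ht := h 0
  unfold triangleOcc at ht
  have hpos : ∃ q, pairOcc σ i q = 1 := by
    by_contra! hne
    have h0 := hne 0
    have h1 := hne (0 + 1)
    have h2 := hne (0 + 2)
    omega
  obtain ⟨q, hq⟩ := hpos
  refine ⟨colColour L q, fun j => ?_⟩
  split_ifs with hj
  · rw [same j q hj, hq]
  · have hw := h q
    unfold triangleOcc at hw
    have : ∀ x y : ZMod 3, x ≠ y → x = y + 1 ∨ x = y + 2 := by decide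
    rcases this _ _ hj with h' | h'
    · rw [same j (q + 1) (by rw [h', map_add, map_one])]
      omega
    · rw [same j (q + 2) (by rw [h', map_add, map_ofNat])]
      omega

theorem FullRow.rowSum_eq {σ : Config K L} {i : ZMod (2 * K)} {k : ZMod 3}
    (h : FullRow σ i k) : rowSum σ i = 2 * L := by
  rw [rowSum, ← card_colour k, Finset.card_filter]
  exact Finset.sum_congr rfl fun j _ => h j

/-- In a full triple column either all sites of the middle column are occupied or none is. -/
theorem pairOcc_mid_const (σ : Config K L) {j : ZMod (6 * L)} (h : colSum σ j = K)
    (i i' : ZMod (2 * K)) : pairOcc σ i (j + 1) = pairOcc σ i' (j + 1) := by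
  rw [colSum_eq_iff] at h
  have step : ∀ i, pairOcc σ (i + 1) (j + 1) = pairOcc σ i (j + 1) := by
    intro i
    have h1 := h i
    have h2 := h (i + 1)
    unfold triangleOcc at h1 h2
    unfold pairOcc at h1 h2 ⊢
    rcases zmod_two_cases (rowParity K i) (colParity L j) with ⟨e1, e2, e3⟩ | ⟨e1, e2, e3⟩
    · have z1 := occ_eq_zero σ (i := i) (j := j + 1) (by simpa using e3)
      have z2 := occ_eq_zero σ (i := i + 1 + 1) (j := j + 1)
        (by rw [map_add, map_add, map_add, map_one, map_one, e1]
            generalize colParity L j = y; revert y; decide)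
      omega
    · have z1 := occ_eq_zero σ (i := i) (j := j) e1
      have z2 := occ_eq_zero σ (i := i) (j := j + 2) (by simpa [colParity_two] using e1)
      have z3 := occ_eq_zero σ (i := i + 1 + 1) (j := j)
        (by rw [map_add, map_add, map_one, e2]
            generalize colParity L j = y; revert y; decide)
      have z4 := occ_eq_zero σ (i := i + 1 + 1) (j := j + 2)
        (by rw [map_add, map_add, map_add, colParity_two, map_one, e2]
            generalize colParity L j = y; revert y; decide)
      have z5 := occ_eq_zero σ (i := i + 1) (j := j + 1)
        (by rw [map_add, map_add, map_one, map_one, e2]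
            generalize colParity L j = y; revert y; decide)
      omega
  have all : ∀ n : ℕ, pairOcc σ (i' + n) (j + 1) = pairOcc σ i' (j + 1) := by
    intro n
    induction n with
    | zero => simp
    | succ n ih => rw [Nat.cast_succ, ← add_assoc, step, ih]
  have := all (i - i').val
  rwa [ZMod.natCast_zmod_val, add_sub_cancel] at this

/-- A full double row and a full triple column whose middle column has the same colour cross in
particles of the middle column. Hence any other full double row has this colour as well. -/
theorem FullRow.colour_unique {σ : Config K L} {i i' : ZMod (2 * K)} {k k' : ZMod 3}
    (h : FullRow σ i k) (h' : FullRow σ i' k') {j : ZMod (6 * L)} (hj : colSum σ j = K)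
    (hk : colColour L (j + 1) = k) : k = k' := by
  have e := pairOcc_mid_const σ hj i i'
  rw [h, h', if_pos hk] at e
  by_contra hne
  rw [if_neg (by rwa [hk])] at e
  exact one_ne_zero e

theorem occ_monochromatic (k : ZMod 3) {i : ZMod (2 * K)} {j : ZMod (6 * L)}
    (h : rowParity K i = colParity L j) :
    occ (monochromatic K L k) i j = if colColour L j = k then 1 else 0 := by
  rw [occ, dif_pos ((even_val_add_iff i j).2 h)]
  have e : colour (⟨(i, j), (even_val_add_iff i j).2 h⟩ : Site K L) = colColour L j := rfl
  simp only [monochromatic, e]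
  by_cases hc : colColour L j = k
  · simp only [if_pos hc]
    rfl
  · simp only [if_neg hc]
    rfl

theorem fullRow_monochromatic (k : ZMod 3) (i : ZMod (2 * K)) :
    FullRow (monochromatic K L k) i k := by
  intro j
  rw [pairOcc]
  rcases zmod_two_cases (rowParity K i) (colParity L j) with ⟨e1, e2, e3⟩ | ⟨e1, e2, e3⟩
  · rw [occ_monochromatic k e1, occ_eq_zero _ (by simpa using e2), add_zero]
  · rw [occ_eq_zero _ e1, occ_monochromatic k (by simpa using e2), zero_add]

theorem count_monochromatic (k : ZMod 3) : count (monochromatic K L k) = 2 * K * L := by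
  have h := sum_rowSum (monochromatic K L k)
  rw [Finset.sum_congr rfl fun i _ => (fullRow_monochromatic k i).rowSum_eq] at h
  simp only [Finset.sum_const, Finset.card_univ, ZMod.card, smul_eq_mul] at h
  nlinarith

/-- If fewer than `K` particles are missing, then some double row is full. -/
theorem exists_rowSum_eq {σ : Config K L} (h : 2 * K * L < count σ + K) :
    ∃ i, rowSum σ i = 2 * L := by
  by_contra! hne
  have hs : ∑ i, (rowSum σ i + 1) ≤ ∑ _i : ZMod (2 * K), 2 * L :=
    Finset.sum_le_sum fun i _ => lt_of_le_of_ne (rowSum_le σ i) (hne i)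
  rw [Finset.sum_add_distrib, sum_rowSum] at hs
  simp only [Finset.sum_const, Finset.card_univ, ZMod.card, smul_eq_mul] at hs
  nlinarith

/-- If fewer than `2L` particles are missing, then some triple column is full, and the colour of
its middle column can be prescribed. -/
theorem exists_colSum_eq {σ : Config K L} (h : 2 * K * L < count σ + 2 * L) (k : ZMod 3) :
    ∃ j, colSum σ j = K ∧ colColour L (j + 1) = k := by
  by_contra! hne
  have hs : ∑ j with colColour L j = k - 1, (colSum σ j + 1) ≤
      ∑ j with colColour L j = k - 1, K :=
    Finset.sum_le_sum fun j hj => lt_of_le_of_ne (colSum_le σ j) fun hj' => hne j hj' (by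
      rw [map_add, (Finset.mem_filter.1 hj).2, map_one, sub_add_cancel])
  rw [Finset.sum_add_distrib, sum_colSum] at hs
  simp only [Finset.sum_const, card_colour, smul_eq_mul] at hs
  nlinarith

theorem eq_monochromatic_of_forall {σ : Config K L} {k : ZMod 3} (h : ∀ i, FullRow σ i k) :
    σ = monochromatic K L k := by
  refine config_ext fun v => ?_
  rw [monochromatic_apply, colour_eq]
  have e := h v.1.1 v.1.2
  have hz : occ σ (v.1.1 + 1) v.1.2 = 0 := occ_eq_zero _ (by
    rw [map_add, map_one, v.parity]
    generalize colParity L v.1.2 = y; revert y; decide)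
  rw [pairOcc, hz, occ_site, add_zero] at e
  split_ifs at e with hc
  · simp only [hc, iff_true]
    omega
  · simp only [hc, iff_false]
    omega

theorem exists_eq_monochromatic {σ : Config K L} (h : count σ = 2 * K * L) :
    ∃ k, σ = monochromatic K L k := by
  have hrow : ∀ i, rowSum σ i = 2 * L := by
    have hs := Finset.sum_eq_sum_iff_of_le (s := Finset.univ)
      (fun i (_ : i ∈ Finset.univ) => rowSum_le σ i)
    rw [sum_rowSum] at hs
    simp only [Finset.sum_const, Finset.card_univ, ZMod.card, smul_eq_mul, Finset.mem_univ,
      forall_const] at hs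
    exact hs.1 (by rw [h]; ring)
  obtain ⟨k, hk⟩ := exists_fullRow σ (hrow 0)
  obtain ⟨j, hj, hjk⟩ := exists_colSum_eq (σ := σ) (by have := NeZero.pos L; omega) k
  refine ⟨k, eq_monochromatic_of_forall fun i => ?_⟩
  obtain ⟨k', hk'⟩ := exists_fullRow σ (hrow i)
  rwa [hk.colour_unique hk' hj hjk]

end

/-! ### The lower bound: the dominant colour does not change below the barrier -/

section

variable {K L : ℕ} [NeZero K] [NeZero L]

/-- `S` arises from `η` by adding at most one particle. -/
def Covers (η S : Config K L) : Prop :=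
  (∀ u, η.1 u = 1 → S.1 u = 1) ∧ ∃ v, ∀ u, u ≠ v → S.1 u = η.1 u

theorem Covers.refl (η : Config K L) : Covers η η :=
  ⟨fun _ h => h, ⟨(0, 0), by simp⟩, fun _ _ => rfl⟩

theorem occ_le_occ {η S : Config K L} (h : ∀ u, η.1 u = 1 → S.1 u = 1) (i : ZMod (2 * K))
    (j : ZMod (6 * L)) : occ η i j ≤ occ S i j := by
  unfold occ
  split_ifs with hp
  · have := h ⟨(i, j), hp⟩
    generalize η.1 ⟨(i, j), hp⟩ = x at *
    generalize S.1 ⟨(i, j), hp⟩ = y at *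
    revert x y
    decide
  · exact le_rfl

theorem occ_congr {η S : Config K L} {i : ZMod (2 * K)} {j : ZMod (6 * L)}
    (h : ∀ u : Site K L, u.1 = (i, j) → S.1 u = η.1 u) : occ S i j = occ η i j := by
  unfold occ
  split_ifs with hp
  · rw [h _ rfl]
  · rfl

theorem count_lt_count {η S : Config K L} (h : ∀ u, η.1 u = 1 → S.1 u = 1) {v : Site K L}
    (hv : η.1 v ≠ 1) (hv' : S.1 v = 1) : count η < count S := by
  refine Finset.sum_lt_sum (fun u _ => ?_) ⟨v, Finset.mem_univ v, ?_⟩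
  · rw [← occ_site, ← occ_site]
    exact occ_le_occ h _ _
  · rw [hv']
    generalize η.1 v = x at *
    revert x
    decide

theorem rowSum_lt_rowSum {η S : Config K L} (h : ∀ u, η.1 u = 1 → S.1 u = 1) {v : Site K L}
    (hv : η.1 v ≠ 1) (hv' : S.1 v = 1) {i : ZMod (2 * K)} (hi : i = v.1.1 ∨ i + 1 = v.1.1) :
    rowSum η i < rowSum S i := by
  have hlt : occ η v.1.1 v.1.2 < occ S v.1.1 v.1.2 := by
    rw [occ_site, occ_site, hv']
    generalize η.1 v = x at *
    revert x
    decide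
  refine Finset.sum_lt_sum (fun j _ => ?_) ⟨v.1.2, Finset.mem_univ _, ?_⟩
  · exact Nat.add_le_add (occ_le_occ h _ _) (occ_le_occ h _ _)
  · have h1 := occ_le_occ h i v.1.2
    have h2 := occ_le_occ h (i + 1) v.1.2
    unfold pairOcc
    rcases hi with hi | hi
    · rw [← hi] at hlt
      omega
    · rw [← hi] at hlt
      omega

theorem colSum_lt_colSum {η S : Config K L} (h : ∀ u, η.1 u = 1 → S.1 u = 1) {v : Site K L}
    (hv : η.1 v ≠ 1) (hv' : S.1 v = 1) {j : ZMod (6 * L)} (hj : j + 1 = v.1.2) :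
    colSum η j < colSum S j := by
  have hlt : occ η v.1.1 v.1.2 < occ S v.1.1 v.1.2 := by
    rw [occ_site, occ_site, hv']
    generalize η.1 v = x at *
    revert x
    decide
  have le := fun i j => occ_le_occ h i j
  refine Finset.sum_lt_sum (fun i _ => ?_) ⟨v.1.1, Finset.mem_univ _, ?_⟩
  · have h1 := le i j
    have h2 := le i (j + 1)
    have h3 := le i (j + 2)
    omega
  · have h1 := le v.1.1 j
    have h3 := le v.1.1 (j + 2)
    rw [← hj] at hlt
    omega

/-- If every double row of `η` lacks exactly one particle and adding a particle at `v` makes `k`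
the only colour of full double rows, then the two double rows that contain `v` become full, in
the colour `k`, which is the colour of `v`. -/
theorem fullRow_of_insert {η S : Config K L} (h : ∀ u, η.1 u = 1 → S.1 u = 1) {v : Site K L}
    (hv : η.1 v ≠ 1) (hv' : S.1 v = 1) (hrow : ∀ i, rowSum η i + 1 = 2 * L) {k : ZMod 3}
    (hk : ∀ i k', FullRow S i k' → k = k') :
    colColour L v.1.2 = k ∧ ∀ i, i = v.1.1 ∨ i + 1 = v.1.1 → FullRow S i k := by
  have hfull : ∀ i, i = v.1.1 ∨ i + 1 = v.1.1 → FullRow S i k := by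
    intro i hi
    have h1 := rowSum_lt_rowSum h hv hv' hi
    have h2 := rowSum_le S i
    have h3 := hrow i
    obtain ⟨k', hk'⟩ := exists_fullRow S (show rowSum S i = 2 * L by omega)
    rwa [hk i k' hk']
  refine ⟨?_, hfull⟩
  by_contra hne
  have e := hfull v.1.1 (Or.inl rfl) v.1.2
  rw [if_neg hne, pairOcc, occ_site, hv'] at e
  have : ((1 : Fin 2) : ℕ) = 1 := rfl
  omega

/-- A configuration that lacks at most `min K 2L` particles cannot be completed to two
configurations with full double rows of different colours by adding at most one particle each.

If `η` has a full double row, or a full triple column of the appropriate colour, then this fixes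
the colour in both completions. Otherwise all double rows and these triple columns lack exactly
one particle each, so that adding a single particle completes the two double rows and a triple
column through it; the crossings of these lines for both completions exclude each other. -/
theorem Covers.colour_unique (hK : 2 ≤ K) {η S S' : Config K L} (h : Covers η S)
    (h' : Covers η S') (hη : 2 * K * L ≤ count η + min K (2 * L))
    (hS : 2 * K * L < count S + min K (2 * L)) (hS' : 2 * K * L < count S' + min K (2 * L))
    {i i' : ZMod (2 * K)} {k k' : ZMod 3} (hi : FullRow S i k) (hi' : FullRow S' i' k') :
    k = k' := by
  have uS : ∀ i₀ k₀, FullRow S i₀ k₀ → k = k₀ := fun i₀ k₀ h₀ => by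
    obtain ⟨j, hj, hjk⟩ := exists_colSum_eq (σ := S) (by omega) k
    exact hi.colour_unique h₀ hj hjk
  have uS' : ∀ i₀ k₀, FullRow S' i₀ k₀ → k' = k₀ := fun i₀ k₀ h₀ => by
    obtain ⟨j, hj, hjk⟩ := exists_colSum_eq (σ := S') (by omega) k'
    exact hi'.colour_unique h₀ hj hjk
  by_contra hne
  have mono : ∀ {T : Config K L}, (∀ u, η.1 u = 1 → T.1 u = 1) → ∀ i j,
      triangleOcc η i j ≤ triangleOcc T i j := by
    intro T hT i j
    have le := fun i j => occ_le_occ hT i j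
    have a1 := le i j
    have a2 := le i (j + 1)
    have a3 := le i (j + 2)
    have a4 := le (i + 1) j
    have a5 := le (i + 1) (j + 1)
    have a6 := le (i + 1) (j + 2)
    unfold triangleOcc pairOcc
    omega
  -- A full double row of `η` stays full with the same colour in both completions.
  have norow : ∀ i₀, rowSum η i₀ ≠ 2 * L := by
    intro i₀ h₀
    have up : ∀ {T : Config K L}, (∀ u, η.1 u = 1 → T.1 u = 1) → rowSum T i₀ = 2 * L := by
      intro T hT
      refine le_antisymm (rowSum_le T i₀) (h₀ ▸ ?_)
      exact Finset.sum_le_sum fun j _ => Nat.add_le_add (occ_le_occ hT _ _) (occ_le_occ hT _ _)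
    obtain ⟨k₀, hk₀⟩ := exists_fullRow η h₀
    obtain ⟨k₁, hk₁⟩ := exists_fullRow S (up h.1)
    obtain ⟨k₂, hk₂⟩ := exists_fullRow S' (up h'.1)
    obtain ⟨j, hj⟩ := exists_colColour (L := L) k₀
    have e0 : 1 ≤ pairOcc η i₀ j := by rw [hk₀ j, if_pos hj]
    have e1 : pairOcc η i₀ j ≤ pairOcc S i₀ j :=
      Nat.add_le_add (occ_le_occ h.1 _ _) (occ_le_occ h.1 _ _)
    have e2 : pairOcc η i₀ j ≤ pairOcc S' i₀ j :=
      Nat.add_le_add (occ_le_occ h'.1 _ _) (occ_le_occ h'.1 _ _)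
    have c1 : colColour L j = k₁ := by
      by_contra hc
      rw [hk₁ j, if_neg hc] at e1
      omega
    have c2 : colColour L j = k₂ := by
      by_contra hc
      rw [hk₂ j, if_neg hc] at e2
      omega
    exact hne ((uS _ _ hk₁).trans (c1.symm.trans (c2.trans (uS' _ _ hk₂).symm)))
  -- A full triple column of `η` stays the same in both completions.
  have nocol : ∀ j, colColour L (j + 1) = k → colSum η j ≠ K := by
    intro j hj h₀
    have h₁ := (colSum_eq_iff η j).1 h₀
    have eqη : ∀ {T : Config K L}, (∀ u, η.1 u = 1 → T.1 u = 1) → ∀ i₀,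
        pairOcc T i₀ (j + 1) = pairOcc η i₀ (j + 1) := by
      intro T hT i₀
      have a0 := h₁ i₀
      have a1 := triangleOcc_le_one T i₀ j
      have le := fun j => Nat.add_le_add (occ_le_occ hT i₀ j) (occ_le_occ hT (i₀ + 1) j)
      have a2 : pairOcc η i₀ j ≤ pairOcc T i₀ j := le j
      have a3 : pairOcc η i₀ (j + 1) ≤ pairOcc T i₀ (j + 1) := le (j + 1)
      have a4 : pairOcc η i₀ (j + 2) ≤ pairOcc T i₀ (j + 2) := le (j + 2)
      unfold triangleOcc at a0 a1
      omega
    have e := pairOcc_mid_const η h₀ i i'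
    rw [← eqη h.1, ← eqη h'.1, hi, hi', if_pos hj, if_neg (by rwa [hj])] at e
    exact one_ne_zero e
  have hrow : ∀ i₀, rowSum η i₀ + 1 = 2 * L := by
    have hle : ∀ i₀ ∈ Finset.univ, rowSum η i₀ + 1 ≤ 2 * L := fun i₀ _ =>
      lt_of_le_of_ne (rowSum_le η i₀) (norow i₀)
    have hs := Finset.sum_le_sum hle
    have heq := Finset.sum_eq_sum_iff_of_le hle
    rw [Finset.sum_add_distrib, sum_rowSum] at hs heq
    simp only [Finset.sum_const, Finset.card_univ, ZMod.card, smul_eq_mul, Finset.mem_univ,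
      forall_const] at hs heq
    have : min K (2 * L) ≤ K := min_le_left _ _
    exact heq.1 (le_antisymm hs (by nlinarith))
  have hcol : ∀ j, colColour L (j + 1) = k → colSum η j + 1 = K := by
    have hle : ∀ j ∈ Finset.univ.filter (fun j => colColour L j = k - 1),
        colSum η j + 1 ≤ K := fun j hj =>
      lt_of_le_of_ne (colSum_le η j) (nocol j (by
        rw [map_add, (Finset.mem_filter.1 hj).2, map_one, sub_add_cancel]))
    have hs := Finset.sum_le_sum hle
    have heq := Finset.sum_eq_sum_iff_of_le hle
    rw [Finset.sum_add_distrib, sum_colSum] at hs heq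
    simp only [Finset.sum_const, card_colour, smul_eq_mul, Finset.mem_filter, Finset.mem_univ,
      true_and] at hs heq
    have : min K (2 * L) ≤ 2 * L := min_le_right _ _
    intro j hj
    refine heq.1 (le_antisymm hs (by nlinarith)) j ?_
    rw [← hj, map_add, map_one, add_sub_cancel_right]
  have added : ∀ {T : Config K L}, Covers η T → (∃ i₀ k₀, FullRow T i₀ k₀) →
      ∃ v, η.1 v ≠ 1 ∧ T.1 v = 1 ∧ ∀ u, u ≠ v → T.1 u = η.1 u := by
    rintro T ⟨hT, v, hv⟩ ⟨i₀, k₀, hf⟩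
    by_cases hη' : η.1 v = T.1 v
    · refine absurd hf.rowSum_eq ?_
      have : T = η := Subtype.ext (funext fun u => by
        by_cases hu : u = v
        · rw [hu, hη']
        · exact hv u hu)
      rw [this]
      exact norow i₀
    · refine ⟨v, fun h1 => hη' (h1.trans (hT v h1).symm), ?_, hv⟩
      have := hT v
      generalize η.1 v = x at *
      generalize T.1 v = y at *
      revert x y
      decide
  obtain ⟨v, hv, hv', hvu⟩ := added h ⟨i, k, hi⟩
  obtain ⟨w, hw, hw', hwu⟩ := added h' ⟨i', k', hi'⟩
  obtain ⟨hvk, hvf⟩ := fullRow_of_insert h.1 hv hv' hrow uS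
  obtain ⟨hwk, hwf⟩ := fullRow_of_insert h'.1 hw hw' hrow uS'
  -- The whole column of `v` is occupied in `S`.
  have hcolv : ∀ i₀, pairOcc S i₀ v.1.2 = 1 := by
    intro i₀
    have h1 := colSum_lt_colSum h.1 hv hv' (sub_add_cancel v.1.2 1)
    have h2 := hcol (v.1.2 - 1) (by rwa [sub_add_cancel])
    have h3 := colSum_le S (v.1.2 - 1)
    have h4 := pairOcc_mid_const S (show colSum S (v.1.2 - 1) = K by omega) i₀ v.1.1
    rw [sub_add_cancel] at h4
    rw [h4, hvf v.1.1 (Or.inl rfl), if_pos hvk]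
  have hmeet : ∀ i₀, i₀ = w.1.1 ∨ i₀ + 1 = w.1.1 → i₀ = v.1.1 ∨ i₀ + 1 = v.1.1 := by
    intro i₀ h₀
    by_contra! hcon
    have e1 := hwf i₀ h₀ v.1.2
    rw [if_neg (by rwa [hvk])] at e1
    have e2 := hcolv i₀
    have e3 : occ S i₀ v.1.2 = occ η i₀ v.1.2 := occ_congr fun u hu => hvu u (by
      rintro rfl
      exact hcon.1 (by rw [hu]))
    have e4 : occ S (i₀ + 1) v.1.2 = occ η (i₀ + 1) v.1.2 := occ_congr fun u hu => hvu u (by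
      rintro rfl
      exact hcon.2 (by rw [hu]))
    have e5 := occ_le_occ h'.1 i₀ v.1.2
    have e6 := occ_le_occ h'.1 (i₀ + 1) v.1.2
    unfold pairOcc at e1 e2
    omega
  have small : ∀ n : ℕ, 0 < n → n < 4 → ((n : ℕ) : ZMod (2 * K)) ≠ 0 := by
    intro n h0 h4 hn
    rw [ZMod.natCast_eq_zero_iff] at hn
    have := Nat.le_of_dvd h0 hn
    omega
  have hrw : w.1.1 = v.1.1 := by
    rcases hmeet w.1.1 (Or.inl rfl) with h1 | h1
    · exact h1
    · exfalso
      rcases hmeet (w.1.1 - 1) (Or.inr (sub_add_cancel _ _)) with h2 | h2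
      · refine small 2 (by norm_num) (by norm_num) ?_
        rw [← h1] at h2
        push_cast
        linear_combination -h2
      · refine small 1 (by norm_num) (by norm_num) ?_
        rw [← h1, sub_add_cancel] at h2
        push_cast
        linear_combination -h2
  -- The next row is the same in both completions, but its particles have colour `k` in `S`
  -- and colour `k'` in `S'`.
  have hq : colColour L (v.1.2 + 3) = k := by
    rw [map_add, hvk, map_ofNat, show (OfNat.ofNat 3 : ZMod 3) = 0 from rfl, add_zero]
  have e1 := hvf v.1.1 (Or.inl rfl) (v.1.2 + 3)
  rw [if_pos hq, pairOcc, occ_eq_zero, zero_add] at e1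
  · have e2 : occ S (v.1.1 + 1) (v.1.2 + 3) = occ η (v.1.1 + 1) (v.1.2 + 3) :=
      occ_congr fun u hu => hvu u (by
        rintro rfl
        have h1 := congrArg Prod.fst hu
        refine small 1 (by norm_num) (by norm_num) ?_
        push_cast
        linear_combination -h1)
    have e3 := occ_le_occ h'.1 (v.1.1 + 1) (v.1.2 + 3)
    have e4 := hwf v.1.1 (Or.inl hrw.symm) (v.1.2 + 3)
    rw [if_neg (by rwa [hq]), pairOcc] at e4
    omega
  · rw [v.parity, map_add, map_ofNat]
    generalize colParity L v.1.2 = y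
    revert y
    decide

/-- The invariant of paths that stay below the barrier: up to one missing particle, `σ` has a
full double row of colour `k`. -/
def Dominated (k : ZMod 3) (σ : Config K L) : Prop :=
  ∃ τ, Covers σ τ ∧ 2 * K * L < count τ + min K (2 * L) ∧ ∃ i, FullRow τ i k

theorem Dominated.step (hK : 2 ≤ K) {k : ZMod 3} {σ σ' : Config K L} (h : Dominated k σ)
    (hσ : 2 * K * L ≤ count σ + min K (2 * L)) (hσ' : 2 * K * L ≤ count σ' + min K (2 * L))
    {v : Site K L} (hv : σ.1 v ≠ σ'.1 v) (hu : ∀ u, u ≠ v → σ.1 u = σ'.1 u) :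
    Dominated k σ' := by
  obtain ⟨τ, hτ, hc, i, hi⟩ := h
  by_cases h1 : σ.1 v = 1
  · have hsub : ∀ u, σ'.1 u = 1 → σ.1 u = 1 := fun u h' => by
      by_cases huv : u = v
      · rwa [huv]
      · rw [hu u huv, h']
    have hlt := count_lt_count hsub (fun h' => hv (h1.trans h'.symm)) h1
    obtain ⟨i', hi'⟩ := exists_rowSum_eq (σ := σ) (by omega)
    obtain ⟨k', hk'⟩ := exists_fullRow σ hi'
    have := hτ.colour_unique hK (.refl σ) hσ hc (by omega) hi hk'
    subst this
    exact ⟨σ, ⟨hsub, v, hu⟩, by omega, i', hk'⟩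
  · have hsub : ∀ u, σ.1 u = 1 → σ'.1 u = 1 := fun u h' => by
      rwa [← hu u (by rintro rfl; exact h1 h')]
    have h1' : σ'.1 v = 1 := by
      generalize σ.1 v = x at *
      generalize σ'.1 v = y at *
      revert x y
      decide
    have hlt := count_lt_count hsub h1 h1'
    obtain ⟨i', hi'⟩ := exists_rowSum_eq (σ := σ') (by omega)
    obtain ⟨k', hk'⟩ := exists_fullRow σ' hi'
    have := hτ.colour_unique hK ⟨hsub, v, fun u h' => (hu u h').symm⟩ hσ hc (by omega) hi hk'
    subst this
    exact ⟨σ', .refl σ', by omega, i', hk'⟩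

theorem distance_eq_one_of_connectivity_pos {σ σ' : Config K L} (h : 0 < connectivity σ σ')
    (hne : σ ≠ σ') : distance σ σ' = 1 := by
  rw [connectivity, if_neg hne, moveWeight] at h
  by_contra hd
  rw [if_neg hd] at h
  exact lt_irrefl _ h

theorem exists_unique_site_of_distance {σ σ' : Config K L} (h : distance σ σ' = 1) :
    ∃ v, σ.1 v ≠ σ'.1 v ∧ ∀ u, u ≠ v → σ.1 u = σ'.1 u := by
  obtain ⟨v, hv⟩ := Finset.card_eq_one.1 h
  have hmem : ∀ u, σ.1 u ≠ σ'.1 u ↔ u = v := fun u => by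
    have := congrArg (u ∈ ·) hv
    simpa using this
  exact ⟨v, (hmem v).2 rfl, fun u hu => not_not.1 fun h' => hu ((hmem u).1 h')⟩

/-- A path between two different monochromatic configurations passes through a configuration
that lacks more than `min K 2L` particles. -/
theorem exists_count_lt_of_path (hK : 2 ≤ K) {k k' : ZMod 3} (hne : k ≠ k')
    (ω : (landscape K L).Path (monochromatic K L k) (monochromatic K L k')) :
    ∃ i, count (ω.point i) + min K (2 * L) < 2 * K * L := by
  by_contra! hω
  have hpos : 0 < min K (2 * L) := by
    have := NeZero.pos L
    omega
  have inv : ∀ i, Dominated k (ω.point i) := by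
    intro i
    induction i using Fin.induction with
    | zero =>
      rw [ω.source]
      exact ⟨_, .refl _, by rw [count_monochromatic]; omega, 0, fullRow_monochromatic k 0⟩
    | succ i ih =>
      by_cases heq : ω.point i.castSucc = ω.point i.succ
      · rwa [← heq]
      · obtain ⟨v, hv, hu⟩ := exists_unique_site_of_distance
          (distance_eq_one_of_connectivity_pos (ω.step i) heq)
        exact ih.step hK (hω _) (hω _) hv hu
  have hend := inv (Fin.last ω.length)
  rw [ω.target] at hend
  obtain ⟨τ, hτ, hc, i, hi⟩ := hend
  have hm := count_monochromatic (K := K) (L := L) k'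
  exact hne (hτ.colour_unique hK (.refl _) (by omega) hc (by omega) hi
    (fullRow_monochromatic k' 0))

end

/-! ### Paths with a bounded number of missing particles -/

section

variable {K L : ℕ} [NeZero K] [NeZero L]

/-- `σ` and `σ'` are joined by a path all of whose moves keep at least `n` particles. -/
def Reach (n : ℕ) (σ σ' : Config K L) : Prop :=
  Relation.ReflTransGen (fun x y => distance x y = 1 ∧ n ≤ count x ∧ n ≤ count y) σ σ'

theorem Reach.refl (n : ℕ) (σ : Config K L) : Reach n σ σ := Relation.ReflTransGen.refl

theorem Reach.trans {n : ℕ} {σ₁ σ₂ σ₃ : Config K L} (h : Reach n σ₁ σ₂) (h' : Reach n σ₂ σ₃) :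
    Reach n σ₁ σ₃ := Relation.ReflTransGen.trans h h'

theorem Reach.symm {n : ℕ} {σ σ' : Config K L} (h : Reach n σ σ') : Reach n σ' σ := by
  induction h with
  | refl => exact .refl n σ
  | @tail x y _ hxy ih =>
    exact Relation.ReflTransGen.head ⟨distance_comm x y ▸ hxy.1, hxy.2.2, hxy.2.1⟩ ih

theorem Reach.mono {m n : ℕ} (hmn : m ≤ n) {σ σ' : Config K L} (h : Reach n σ σ') :
    Reach m σ σ' :=
  Relation.ReflTransGen.mono (fun _ _ hxy => ⟨hxy.1, hmn.trans hxy.2.1, hmn.trans hxy.2.2⟩) _ _ h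

theorem Reach.exists_path {n : ℕ} {σ σ' : Config K L} (h : Reach n σ σ') (hσ : n ≤ count σ) :
    ∃ ω : (landscape K L).Path σ σ', ∀ i, n ≤ count (ω.point i) := by
  induction h using Relation.ReflTransGen.head_induction_on with
  | refl => exact ⟨⟨0, fun _ => σ', rfl, rfl, fun i => i.elim0⟩, fun _ => hσ⟩
  | @head x y hxy _ ih =>
    obtain ⟨⟨l, f, h0, h1, hs⟩, hf⟩ := ih hxy.2.2
    refine ⟨⟨l + 1, Fin.cons x f, rfl, ?_, ?_⟩, ?_⟩
    · rw [← Fin.succ_last, Fin.cons_succ, h1]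
    · intro i
      refine Fin.cases ?_ (fun j => ?_) i
      · rw [Fin.castSucc_zero, Fin.cons_zero, Fin.cons_succ, h0]
        exact connectivity_pos hxy.1
      · rw [← Fin.succ_castSucc, Fin.cons_succ, Fin.cons_succ]
        exact hs j
    · intro i
      refine Fin.cases ?_ (fun j => ?_) i
      · exact hσ
      · simpa using hf j

theorem Reach.commHeight_le {n : ℕ} {σ σ' : Config K L} (h : Reach n σ σ') (hσ : n ≤ count σ) :
    (landscape K L).commHeight σ σ' ≤ -(n : ℝ) := by
  obtain ⟨ω, hω⟩ := h.exists_path hσ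
  refine (((landscape K L).isLeast_commHeight ⟨ω⟩).2 ⟨ω, rfl⟩).trans ?_
  refine Finset.sup'_le _ _ fun i _ => ?_
  change energy (ω.point i) ≤ _
  rw [energy_eq, neg_le_neg_iff]
  exact_mod_cast hω i

open Classical in
/-- Remove all particles outside of a set of sites. -/
noncomputable def restrict (σ : Config K L) (p : Site K L → Prop) : Config K L :=
  ⟨fun v => if p v then σ.1 v else 0, by
    intro v w h
    have := σ.2 v w h
    by_cases hv : p v <;> by_cases hw : p w <;> simp [hv, hw, this]⟩

theorem restrict_apply {σ : Config K L} {p : Site K L → Prop} {v : Site K L} (h : p v) :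
    (restrict σ p).1 v = σ.1 v := if_pos h

theorem restrict_eq_one_iff {σ : Config K L} {p : Site K L → Prop} {v : Site K L} :
    (restrict σ p).1 v = 1 ↔ σ.1 v = 1 ∧ p v := by
  by_cases h : p v <;> simp [restrict, h]

theorem count_le_count {η S : Config K L} (h : ∀ u, η.1 u = 1 → S.1 u = 1) :
    count η ≤ count S :=
  Finset.sum_le_sum fun u _ => by
    rw [← occ_site, ← occ_site]
    exact occ_le_occ h _ _

/-- Particles can be removed one by one. -/
theorem reach_of_subset {τ σ : Config K L} (h : ∀ u, τ.1 u = 1 → σ.1 u = 1) :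
    Reach (count τ) σ τ := by
  induction hn : count σ using Nat.strong_induction_on generalizing σ with
  | _ n ih =>
    by_cases heq : ∃ v, τ.1 v ≠ 1 ∧ σ.1 v = 1
    · obtain ⟨v, hv, hv'⟩ := heq
      have h1 : ∀ u, (restrict σ (· ≠ v)).1 u = 1 → σ.1 u = 1 := fun u hu =>
        (restrict_eq_one_iff.1 hu).1
      have h2 : ∀ u, τ.1 u = 1 → (restrict σ (· ≠ v)).1 u = 1 := fun u hu =>
        restrict_eq_one_iff.2 ⟨h u hu, by rintro rfl; exact hv hu⟩
      have hlt := count_lt_count h1 (v := v) (fun h' => (restrict_eq_one_iff.1 h').2 rfl) hv'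
      refine Relation.ReflTransGen.head ⟨?_, count_le_count h, count_le_count h2⟩
        (ih _ (hn ▸ hlt) h2 rfl)
      refine Finset.card_eq_one.2 ⟨v, ?_⟩
      ext u
      by_cases hu : u = v
      · simp [hu, restrict, hv']
      · simp [hu, restrict]
    · push Not at heq
      have : σ = τ := config_ext fun u => ⟨fun h' => by
        by_contra hu
        exact heq u hu h', h u⟩
      rw [this]
      exact .refl _ _

/-! ### Inserting particles of a fixed colour -/

/-- `σ'` arises from `σ` by adding particles of colour `k` and removing particles of other
colours. -/
def Towards (k : ZMod 3) (σ σ' : Config K L) : Prop :=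
  ∀ u, (colour u = k → σ.1 u = 1 → σ'.1 u = 1) ∧ (colour u ≠ k → σ'.1 u = 1 → σ.1 u = 1)

theorem Towards.refl (k : ZMod 3) (σ : Config K L) : Towards k σ σ :=
  fun _ => ⟨fun _ h => h, fun _ h => h⟩

theorem Towards.trans {k : ZMod 3} {σ₁ σ₂ σ₃ : Config K L} (h : Towards k σ₁ σ₂)
    (h' : Towards k σ₂ σ₃) : Towards k σ₁ σ₃ :=
  fun u => ⟨fun hu h1 => (h' u).1 hu ((h u).1 hu h1), fun hu h1 => (h u).2 hu ((h' u).2 hu h1)⟩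

open Classical in
/-- The occupied neighbours of a site. -/
noncomputable def blockers (σ : Config K L) (v : Site K L) : Finset (Site K L) :=
  Finset.univ.filter fun u => (grid K L).Adj v u ∧ σ.1 u = 1

theorem mem_blockers {σ : Config K L} {u v : Site K L} :
    u ∈ blockers σ v ↔ (grid K L).Adj v u ∧ σ.1 u = 1 := by
  simp [blockers]

/-- Removing the occupied neighbours of `v` and then occupying `v`. -/
theorem exists_insert (σ : Config K L) (v : Site K L) {b : ℕ} (hb : 1 ≤ b)
    (h : (blockers σ v).card ≤ b) :
    ∃ σ' : Config K L, Towards (colour v) σ σ' ∧ σ'.1 v = 1 ∧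
      (∀ u, u ≠ v → ¬ (grid K L).Adj v u → σ'.1 u = σ.1 u) ∧
      Reach (count σ - b) σ σ' ∧ count σ + 1 ≤ count σ' + b := by
  classical
  by_cases hv : σ.1 v = 1
  · exact ⟨σ, .refl _ _, hv, fun _ _ _ => rfl, .refl _ _, by omega⟩
  let σ' : Config K L := ⟨fun u => if u = v then 1 else if (grid K L).Adj v u then 0 else σ.1 u, by
    intro u w huw
    by_cases hu : u = v
    · subst hu
      have hw : w ≠ u := huw.ne'
      simp [hw, huw]
    · by_cases hw : w = v
      · subst hw
        simp [hu, huw.symm]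
      · by_cases h1 : (grid K L).Adj v u
        · simp [hu, h1]
        · by_cases h2 : (grid K L).Adj v w
          · simp [hw, h2]
          · simpa [hu, hw, h1, h2] using σ.2 u w huw⟩
  have hσ'v : σ'.1 v = 1 := if_pos rfl
  have hσ'adj : ∀ u, (grid K L).Adj v u → σ'.1 u ≠ 1 := fun u hu h' =>
    σ'.not_adj hσ'v h' hu
  have hσ'rest : ∀ u, u ≠ v → ¬ (grid K L).Adj v u → σ'.1 u = σ.1 u := fun u hu hu' =>
    (if_neg hu).trans (if_neg hu')
  let τ := restrict σ fun u => ¬ (grid K L).Adj v u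
  have hτσ : ∀ u, τ.1 u = 1 → σ.1 u = 1 := fun u hu => (restrict_eq_one_iff.1 hu).1
  have hτσ' : ∀ u, τ.1 u = 1 → σ'.1 u = 1 := fun u hu => by
    obtain ⟨h1, h2⟩ := restrict_eq_one_iff.1 hu
    by_cases huv : u = v
    · rw [huv, hσ'v]
    · rw [hσ'rest u huv h2, h1]
  have hcount : count σ ≤ count τ + b := by
    refine le_trans ?_ (Nat.add_le_add_left h _)
    rw [blockers, Finset.card_filter, count, count, ← Finset.sum_add_distrib]
    refine Finset.sum_le_sum fun u _ => ?_
    by_cases hu : (grid K L).Adj v u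
    · by_cases hu' : σ.1 u = 1
      · simp [hu, hu']
      · have : σ.1 u = 0 := by
          by_contra h'
          exact hu' (eq_one_of_ne_zero h')
        simp [this]
    · have : τ.1 u = σ.1 u := restrict_apply hu
      rw [this]
      omega
  have hlt := count_lt_count hτσ' (v := v) (fun h' => hv (hτσ v h')) hσ'v
  refine ⟨σ', fun u => ⟨fun hu h1 => ?_, fun hu h1 => ?_⟩, hσ'v, hσ'rest, ?_, by omega⟩
  · refine hτσ' u (restrict_eq_one_iff.2 ⟨h1, fun h' => ?_⟩)
    exact colour_ne_of_adj h' hu.symm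
  · have huv : u ≠ v := by
      rintro rfl
      exact hu rfl
    rwa [← hσ'rest u huv fun h' => hσ'adj u h' h1]
  · exact Reach.mono (show count σ - b ≤ count τ by omega)
      ((reach_of_subset hτσ).trans (reach_of_subset hτσ').symm)

theorem exists_site {i : ZMod (2 * K)} {j : ZMod (6 * L)} (h : rowParity K i = colParity L j) :
    ∃ u : Site K L, u.1 = (i, j) :=
  ⟨⟨(i, j), (even_val_add_iff i j).2 h⟩, rfl⟩

theorem zmod_three_cases {x k : ZMod 3} (h : x ≠ k) : x + 1 = k ∨ x = k + 1 := by
  revert x k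
  decide

theorem eq_monochromatic_of_forall_occupied {σ : Config K L} {k : ZMod 3}
    (h : ∀ u, colour u = k → σ.1 u = 1) : σ = monochromatic K L k := by
  refine config_ext fun u => ?_
  rw [monochromatic_apply]
  refine ⟨fun hu => ?_, h u⟩
  by_contra hne
  rw [colour_eq] at hne
  rcases zmod_three_cases hne with hc | hc
  · obtain ⟨w, hw⟩ := exists_site (K := K) (L := L) (i := u.1.1 + 1) (j := u.1.2 + 1)
      (by rw [map_add, map_add, u.parity, map_one, map_one])
    refine σ.not_adj hu (h w ?_) (adj_of_sub (.inr (.inl hw)))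
    rw [colour_eq, hw, map_add, map_one, hc]
  · obtain ⟨w, hw⟩ := exists_site (K := K) (L := L) (i := u.1.1 + 1) (j := u.1.2 - 1)
      (by rw [map_add, map_sub, u.parity, map_one, map_one]
          generalize colParity L u.1.2 = y; revert y; decide)
    refine σ.not_adj hu (h w ?_) (adj_of_sub (.inr (.inr (by rw [hw]; ext <;> simp; ring))))
    rw [colour_eq, hw, map_sub, map_one, hc, add_sub_cancel_right]

/-! ### Sweeping the rows -/

/-- All particles in row `r` have colour `k`. -/
def RowOnly (σ : Config K L) (r : ZMod (2 * K)) (k : ZMod 3) : Prop :=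
  ∀ u : Site K L, u.1.1 = r → σ.1 u = 1 → colour u = k

/-- All sites of colour `k` in row `r` are occupied. -/
def RowFilled (σ : Config K L) (r : ZMod (2 * K)) (k : ZMod 3) : Prop :=
  ∀ u : Site K L, u.1.1 = r → colour u = k → σ.1 u = 1

theorem RowOnly.of_towards {σ σ' : Config K L} {r : ZMod (2 * K)} {k : ZMod 3}
    (h : RowOnly σ r k) (h' : Towards k σ σ') : RowOnly σ' r k := fun u hu hu' => by
  by_contra hne
  exact hne (h u hu ((h' u).2 hne hu'))

theorem RowFilled.of_towards {σ σ' : Config K L} {r : ZMod (2 * K)} {k : ZMod 3}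
    (h : RowFilled σ r k) (h' : Towards k σ σ') : RowFilled σ' r k := fun u hu hc =>
  (h' u).1 hc (h u hu hc)

theorem RowFilled.rowOnly_succ {σ : Config K L} {r : ZMod (2 * K)} {k : ZMod 3}
    (h : RowFilled σ r k) : RowOnly σ (r + 1) k := by
  intro u hu hu'
  by_contra hne
  rw [colour_eq] at hne
  rcases zmod_three_cases hne with hc | hc
  · obtain ⟨w, hw⟩ := exists_site (K := K) (L := L) (i := r) (j := u.1.2 + 1)
      (by have := u.parity
          rw [hu, map_add, map_one] at this
          rw [map_add, map_one, ← this]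
          generalize rowParity K r = y; revert y; decide)
    refine σ.not_adj (h w (by rw [hw]) ?_) hu' (adj_of_sub (.inr (.inr ?_)))
    · rw [colour_eq, hw, map_add, map_one, hc]
    · rw [hw]
      ext <;> simp [hu]
  · obtain ⟨w, hw⟩ := exists_site (K := K) (L := L) (i := r) (j := u.1.2 - 1)
      (by have := u.parity
          rw [hu, map_add, map_one] at this
          rw [map_sub, map_one, ← this, add_sub_cancel_right])
    refine σ.not_adj (h w (by rw [hw]) ?_) hu' (adj_of_sub (.inr (.inl ?_)))
    · rw [colour_eq, hw, map_sub, map_one, hc, add_sub_cancel_right]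
    · rw [hw]
      ext <;> simp [hu]

/-- If the rows `r` and `r + 1` only contain particles of colour `k`, then a site of colour `k` in
row `r + 1` can only be blocked from row `r + 2`, where its two neighbours are adjacent. -/
theorem card_blockers_row {σ : Config K L} {r : ZMod (2 * K)} {k : ZMod 3} (h : RowOnly σ r k)
    (h' : RowOnly σ (r + 1) k) {v : Site K L} (hv : v.1.1 = r + 1) (hk : colour v = k) :
    (blockers σ v).card ≤ 1 := by
  have key : ∀ u ∈ blockers σ v, u.1 = v.1 + (1, 1) ∨ u.1 = v.1 + (1, -1) := by
    intro u hu
    obtain ⟨hadj, hocc⟩ := mem_blockers.1 hu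
    have hne : colour u ≠ k := fun hc => colour_ne_of_adj hadj (hk.trans hc.symm)
    have n1 : u.1.1 ≠ r + 1 := fun hr => hne (h' u hr hocc)
    have n2 : u.1.1 ≠ r := fun hr => hne (h u hr hocc)
    rcases adj_cases hadj with (e | e | e) | (e | e | e)
    · exact absurd (by rw [e, ← hv]; simp) n1
    · exact .inl e
    · exact .inr e
    · exact absurd (by rw [← hv, e]; simp) n1
    · exact absurd (add_right_cancel (b := 1) (by rw [← hv, e]; simp)) n2
    · exact absurd (add_right_cancel (b := 1) (by rw [← hv, e]; simp)) n2
  refine Finset.card_le_one.2 fun u hu w hw => ?_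
  have ou := (mem_blockers.1 hu).2
  have ow := (mem_blockers.1 hw).2
  rcases key u hu with e1 | e1 <;> rcases key w hw with e2 | e2
  · exact Subtype.ext (e1.trans e2.symm)
  · refine absurd (adj_of_sub (.inl ?_)) (σ.not_adj ow ou)
    rw [e1, e2]
    ext <;> simp
    ring
  · refine absurd (adj_of_sub (.inl ?_)) (σ.not_adj ou ow)
    rw [e1, e2]
    ext <;> simp
    ring
  · exact Subtype.ext (e1.trans e2.symm)

theorem exists_rowFilled {σ : Config K L} {r : ZMod (2 * K)} {k : ZMod 3} (h : RowOnly σ r k)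
    (h' : RowOnly σ (r + 1) k) :
    ∃ σ' : Config K L, Towards k σ σ' ∧ RowFilled σ' (r + 1) k ∧ Reach (count σ - 1) σ σ' ∧
      count σ ≤ count σ' := by
  classical
  have key : ∀ A : Finset (Site K L), (∀ u ∈ A, u.1.1 = r + 1 ∧ colour u = k) →
      ∃ σ' : Config K L, Towards k σ σ' ∧ (∀ u ∈ A, σ'.1 u = 1) ∧ Reach (count σ - 1) σ σ' ∧
        count σ ≤ count σ' := by
    intro A
    induction A using Finset.induction_on with
    | empty => exact fun _ => ⟨σ, .refl _ _, by simp, .refl _ _, le_rfl⟩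
    | insert v A _ ih =>
      intro hA
      obtain ⟨σ₁, t₁, o₁, p₁, c₁⟩ := ih fun u hu => hA u (Finset.mem_insert_of_mem hu)
      obtain ⟨hv, hk⟩ := hA v (Finset.mem_insert_self v A)
      obtain ⟨σ₂, t₂, o₂, -, p₂, c₂⟩ := exists_insert σ₁ v le_rfl
        (card_blockers_row (h.of_towards t₁) (h'.of_towards t₁) hv hk)
      rw [hk] at t₂
      refine ⟨σ₂, t₁.trans t₂, fun u hu => ?_, p₁.trans (p₂.mono (by omega)), by omega⟩
      rcases Finset.mem_insert.1 hu with rfl | hu'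
      · exact o₂
      · exact (t₂ u).1 (hA u hu).2 (o₁ u hu')
  obtain ⟨σ', t, o, p, c⟩ := key (Finset.univ.filter fun u => u.1.1 = r + 1 ∧ colour u = k)
    (fun u hu => (Finset.mem_filter.1 hu).2)
  exact ⟨σ', t, fun u h1 h2 => o u (Finset.mem_filter.2 ⟨Finset.mem_univ _, h1, h2⟩), p, c⟩

/-- Starting next to a pair of rows without particles of other colours, colour `k` can invade the
grid row by row, at the expense of at most one particle at a time. -/
theorem reach_of_rowOnly {τ : Config K L} {r : ZMod (2 * K)} {k : ZMod 3} (h : RowOnly τ r k)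
    (h' : RowOnly τ (r + 1) k) : Reach (count τ - 1) τ (monochromatic K L k) := by
  have key : ∀ s : ℕ, ∃ σ : Config K L, Towards k τ σ ∧ Reach (count τ - 1) τ σ ∧
      count τ ≤ count σ ∧ (∀ t : ℕ, t < s → RowFilled σ (r + t + 1) k) ∧
      RowOnly σ (r + s) k ∧ RowOnly σ (r + s + 1) k := by
    intro s
    induction s with
    | zero =>
      exact ⟨τ, .refl _ _, .refl _ _, le_rfl, fun t ht => absurd ht (Nat.not_lt_zero t),
        by simpa using h, by simpa using h'⟩
    | succ s ih =>
      obtain ⟨σ₁, t₁, p₁, c₁, f₁, o₁, o₁'⟩ := ih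
      obtain ⟨σ₂, t₂, f₂, p₂, c₂⟩ := exists_rowFilled o₁ o₁'
      refine ⟨σ₂, t₁.trans t₂, p₁.trans (p₂.mono (by omega)), c₁.trans c₂, fun t ht => ?_, ?_, ?_⟩
      · rcases Nat.lt_succ_iff_lt_or_eq.1 ht with ht' | rfl
        · exact (f₁ t ht').of_towards t₂
        · exact f₂
      · rw [Nat.cast_succ, ← add_assoc]
        exact o₁'.of_towards t₂
      · rw [Nat.cast_succ, ← add_assoc]
        exact f₂.rowOnly_succ
  obtain ⟨σ, -, p, -, f, -, -⟩ := key (2 * K)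
  rwa [← eq_monochromatic_of_forall_occupied (σ := σ) (k := k) fun u hu => ?_]
  refine f (u.1.1 - (r + 1)).val (ZMod.val_lt _) u ?_ hu
  rw [ZMod.natCast_zmod_val]
  ring

/-! ### Sweeping the columns -/

/-- Column `j` contains no particle. -/
def ColEmpty (σ : Config K L) (j : ZMod (6 * L)) : Prop :=
  ∀ u : Site K L, u.1.2 = j → σ.1 u ≠ 1

/-- All sites of column `j` are occupied. -/
def ColFilled (σ : Config K L) (j : ZMod (6 * L)) : Prop :=
  ∀ u : Site K L, u.1.2 = j → σ.1 u = 1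

theorem ColFilled.colEmpty_succ {σ : Config K L} {j : ZMod (6 * L)} (h : ColFilled σ j) :
    ColEmpty σ (j + 1) := by
  intro u hu hu'
  obtain ⟨w, hw⟩ := exists_site (K := K) (L := L) (i := u.1.1 - 1) (j := j)
    (by rw [map_sub, map_one, u.parity, hu, map_add, map_one, add_sub_cancel_right])
  refine σ.not_adj (h w (by rw [hw])) hu' (adj_of_sub (.inr (.inl ?_)))
  rw [hw]
  ext <;> simp [hu]

theorem ColFilled.colEmpty_add_two {σ : Config K L} {j : ZMod (6 * L)} (h : ColFilled σ j) :
    ColEmpty σ (j + 2) := by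
  intro u hu hu'
  obtain ⟨w, hw⟩ := exists_site (K := K) (L := L) (i := u.1.1) (j := j)
    (by rw [u.parity, hu, map_add, colParity_two, add_zero])
  refine σ.not_adj (h w (by rw [hw])) hu' (adj_of_sub (.inl ?_))
  rw [hw]
  ext <;> simp [hu]

theorem ColFilled.colSum_eq {σ : Config K L} {j : ZMod (6 * L)} (h : ColFilled σ j) :
    colSum σ j = K := by
  refine (colSum_eq_iff σ j).2 fun i => le_antisymm (triangleOcc_le_one σ i j) ?_
  have site : ∀ i', rowParity K i' = colParity L j → occ σ i' j = 1 := by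
    intro i' hi'
    obtain ⟨w, hw⟩ := exists_site (K := K) (L := L) hi'
    have := occ_site σ w
    rw [hw, h w (by rw [hw])] at this
    exact this
  unfold triangleOcc pairOcc
  rcases zmod_two_cases (rowParity K i) (colParity L j) with ⟨e1, e2, e3⟩ | ⟨e1, e2, e3⟩
  · have := site i e1
    omega
  · have := site (i + 1) (by simpa using e2)
    omega

/-- If the two columns to the left of `v` are empty, then its possible blockers other than the
lower right neighbour are adjacent to each other. -/
theorem card_blockers_col {σ : Config K L} {j : ZMod (6 * L)} (h : ColEmpty σ j)
    (h' : ColEmpty σ (j + 1)) {v : Site K L} (hv : v.1.2 = j + 2) :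
    ((blockers σ v).filter fun u => u.1 ≠ v.1 + (-1, 1)).card ≤ 1 := by
  have key : ∀ u ∈ (blockers σ v).filter fun u => u.1 ≠ v.1 + (-1, 1),
      u.1 = v.1 + (0, 2) ∨ u.1 = v.1 + (1, 1) := by
    intro u hu
    obtain ⟨hb, hne⟩ := Finset.mem_filter.1 hu
    obtain ⟨hadj, hocc⟩ := mem_blockers.1 hb
    have n1 : u.1.2 ≠ j + 1 := fun hr => h' u hr hocc
    have n2 : u.1.2 ≠ j := fun hr => h u hr hocc
    rcases adj_cases hadj with (e | e | e) | (e | e | e)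
    · exact .inl e
    · exact .inr e
    · exact absurd (by rw [e, Prod.snd_add, hv]; ring) n1
    · exact absurd (add_right_cancel (b := 2) (by rw [← hv, e, Prod.snd_add])) n2
    · refine absurd (add_right_cancel (b := 1) ?_) n1
      have := congrArg Prod.snd e
      rw [hv] at this
      rw [show j + 1 + 1 = j + 2 by ring, this, Prod.snd_add]
    · refine absurd ?_ hne
      rw [e]
      ext <;> simp
  refine Finset.card_le_one.2 fun u hu w hw => ?_
  have ou := (mem_blockers.1 (Finset.mem_filter.1 hu).1).2
  have ow := (mem_blockers.1 (Finset.mem_filter.1 hw).1).2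
  rcases key u hu with e1 | e1 <;> rcases key w hw with e2 | e2
  · exact Subtype.ext (e1.trans e2.symm)
  · refine absurd (adj_of_sub (.inr (.inr ?_))) (σ.not_adj ou ow)
    rw [e1, e2]
    ext <;> simp
    ring
  · refine absurd (adj_of_sub (.inr (.inr ?_))) (σ.not_adj ow ou)
    rw [e1, e2]
    ext <;> simp
    ring
  · exact Subtype.ext (e1.trans e2.symm)

theorem card_blockers_col_le_two {σ : Config K L} {j : ZMod (6 * L)} (h : ColEmpty σ j)
    (h' : ColEmpty σ (j + 1)) {v : Site K L} (hv : v.1.2 = j + 2) :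
    (blockers σ v).card ≤ 2 := by
  have h1 := card_blockers_col h h' hv
  have h2 : ((blockers σ v).filter fun u => ¬ u.1 ≠ v.1 + (-1, 1)).card ≤ 1 := by
    refine Finset.card_le_one.2 fun u hu w hw => Subtype.ext ?_
    have e1 := not_not.1 (Finset.mem_filter.1 hu).2
    have e2 := not_not.1 (Finset.mem_filter.1 hw).2
    rw [e1, e2]
  have := Finset.card_filter_add_card_filter_not (s := blockers σ v)
    (fun u => u.1 ≠ v.1 + (-1, 1))
  omega

theorem card_blockers_col_le_one {σ : Config K L} {j : ZMod (6 * L)} (h : ColEmpty σ j)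
    (h' : ColEmpty σ (j + 1)) {v : Site K L} (hv : v.1.2 = j + 2)
    (hw : ∀ u : Site K L, u.1 = v.1 + (-1, 1) → σ.1 u ≠ 1) : (blockers σ v).card ≤ 1 := by
  have h1 := card_blockers_col h h' hv
  rwa [Finset.filter_true_of_mem (p := fun u : Site K L => u.1 ≠ v.1 + (-1, 1))
    fun u hu hu' => hw u hu' (mem_blockers.1 hu).2] at h1

/-- If the columns `j` and `j + 1` are empty, then column `j + 2` can be filled from bottom to top.
The first insertion removes up to two particles if column `j + 3` is full; apart from that, every
insertion removes at most one particle, as the particle inserted just below the site excludes its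
lower right neighbour. -/
theorem exists_colFilled {σ : Config K L} {j : ZMod (6 * L)} (h : ColEmpty σ j)
    (h' : ColEmpty σ (j + 1)) {b : ℕ} (hb : 1 ≤ b)
    (hb' : 2 ≤ b ∨ ∃ u : Site K L, u.1.2 = j + 3 ∧ σ.1 u ≠ 1) :
    ∃ σ' : Config K L, Towards (colColour L (j + 2)) σ σ' ∧ ColFilled σ' (j + 2) ∧
      Reach (count σ - b) σ σ' ∧ count σ ≤ count σ' := by
  set k := colColour L (j + 2) with hk
  have colj : colColour L j ≠ k := by
    rw [hk, map_add, map_ofNat]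
    generalize colColour L j = x; revert x; decide
  have colj' : colColour L (j + 1) ≠ k := by
    rw [hk, map_add, map_add, map_ofNat, map_one]
    generalize colColour L j = x; revert x; decide
  have emp : ∀ {σ' : Config K L} {q}, ColEmpty σ q → colColour L q ≠ k → Towards k σ σ' →
      ColEmpty σ' q := fun {σ'} {q} hq hc t u hu hu' =>
    hq u hu ((t u).2 (by rwa [colour_eq, hu]) hu')
  obtain ⟨v₀, hv₀, hbl⟩ : ∃ v : Site K L, v.1.2 = j + 2 ∧ (blockers σ v).card ≤ b := by
    rcases hb' with hb' | ⟨u, hu, hu'⟩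
    · have : ∃ i : ZMod (2 * K), rowParity K i = colParity L (j + 2) := by
        have : ∀ y : ZMod 2, y = 0 ∨ y = 1 := by decide
        rcases this (colParity L (j + 2)) with e | e
        · exact ⟨0, by rw [e, map_zero]⟩
        · exact ⟨1, by rw [e, map_one]⟩
      obtain ⟨i, hi⟩ := this
      obtain ⟨v, hv⟩ := exists_site (K := K) (L := L) hi
      have hv2 : v.1.2 = j + 2 := by rw [hv]
      exact ⟨v, hv2, (card_blockers_col_le_two h h' hv2).trans hb'⟩
    · obtain ⟨v, hv⟩ := exists_site (K := K) (L := L) (i := u.1.1 + 1) (j := j + 2)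
        (by rw [map_add, map_one, u.parity, hu, map_add, map_add, colParity_two, map_ofNat]
            generalize colParity L j = y; revert y; decide)
      have hv2 : v.1.2 = j + 2 := by rw [hv]
      refine ⟨v, hv2, (card_blockers_col_le_one h h' hv2 fun w hw => ?_).trans hb⟩
      have : w = u := by
        apply Subtype.ext
        rw [hw, hv]
        ext
        · simp
        · simp [hu]
          ring
      rwa [this]
  have agreeStep : ∀ {σ₁ σ₂ : Config K L} {v : Site K L}, v.1.2 = j + 2 → Towards k σ σ₁ →
      Towards k σ₁ σ₂ → (∀ u, u ≠ v → ¬ (grid K L).Adj v u → σ₂.1 u = σ₁.1 u) →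
      ∀ u : Site K L, u.1.2 ≠ j + 2 → u.1.2 ≠ j + 3 → u.1.2 ≠ j + 4 → σ₂.1 u = σ₁.1 u := by
    intro σ₁ σ₂ v hv t₁ t₂ hag u n2 n3 n4
    by_cases hadj : (grid K L).Adj v u
    · have hu : u.1.2 = j ∨ u.1.2 = j + 1 := by
        have e0 : ∀ x : ZMod (2 * K) × ZMod (6 * L), u.1 = v.1 + x → u.1.2 = j + 2 + x.2 :=
          fun x e => by rw [e, Prod.snd_add, hv]
        have e1 : ∀ x : ZMod (2 * K) × ZMod (6 * L), v.1 = u.1 + x → u.1.2 = j + 2 - x.2 :=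
          fun x e => by rw [← hv, e, Prod.snd_add, add_sub_cancel_right]
        rcases adj_cases hadj with (e | e | e) | (e | e | e)
        · exact absurd ((e0 _ e).trans (by ring)) n4
        · exact absurd ((e0 _ e).trans (by ring)) n3
        · exact .inr ((e0 _ e).trans (by ring))
        · exact .inl ((e1 _ e).trans (by ring))
        · exact .inr ((e1 _ e).trans (by ring))
        · exact absurd ((e1 _ e).trans (by ring)) n3
      have z1 : σ₁.1 u ≠ 1 := by
        rcases hu with hu | hu
        · exact emp h colj t₁ u hu
        · exact emp h' colj' t₁ u hu
      have z2 : σ₂.1 u ≠ 1 := by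
        rcases hu with hu | hu
        · exact emp h colj (t₁.trans t₂) u hu
        · exact emp h' colj' (t₁.trans t₂) u hu
      generalize σ₁.1 u = x at *
      generalize σ₂.1 u = y at *
      revert x y
      decide
    · exact hag u (by rintro rfl; exact n2 hv) hadj
  have key : ∀ s : ℕ, ∃ σ' : Config K L, Towards k σ σ' ∧
      (∀ u : Site K L, u.1.2 ≠ j + 2 → u.1.2 ≠ j + 3 → u.1.2 ≠ j + 4 → σ'.1 u = σ.1 u) ∧
      Reach (count σ - b) σ σ' ∧ count σ + 1 ≤ count σ' + b ∧
      ∀ t : ℕ, t ≤ s → ∀ u : Site K L, u.1 = (v₀.1.1 + 2 * t, j + 2) → σ'.1 u = 1 := by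
    intro s
    induction s with
    | zero =>
      obtain ⟨σ', t', o, ag, p, c⟩ := exists_insert σ v₀ hb hbl
      rw [colour_eq, hv₀] at t'
      refine ⟨σ', t', agreeStep hv₀ (.refl _ _) t' ag, p, c, fun t ht u hu => ?_⟩
      have : u = v₀ := by
        apply Subtype.ext
        rw [hu, Nat.le_zero.1 ht, ← hv₀]
        simp
      rwa [this]
    | succ s ih =>
      obtain ⟨σ₁, t₁, a₁, p₁, c₁, o₁⟩ := ih
      have par : ∀ t : ℕ, rowParity K (v₀.1.1 + 2 * t) = colParity L (j + 2) := by
        intro t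
        rw [map_add, map_mul, v₀.parity, hv₀, map_ofNat,
          show (OfNat.ofNat 2 : ZMod 2) = 0 from rfl, zero_mul, add_zero]
      obtain ⟨v, hv⟩ := exists_site (par (s + 1))
      obtain ⟨w, hw⟩ := exists_site (par s)
      have hv2 : v.1.2 = j + 2 := by rw [hv]
      have bl := card_blockers_col_le_one (emp h colj t₁) (emp h' colj' t₁) hv2
        (fun u hu hu' => σ₁.not_adj (o₁ s le_rfl w hw) hu' (adj_of_sub (.inr (.inl (by
          rw [hu, hv, hw]
          ext
          · simp
            ring
          · simp)))))
      obtain ⟨σ₂, t₂, o₂, ag, p₂, c₂⟩ := exists_insert σ₁ v le_rfl bl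
      rw [colour_eq, hv2] at t₂
      refine ⟨σ₂, t₁.trans t₂, fun u n2 n3 n4 => ?_, p₁.trans (p₂.mono (by omega)), by omega,
        fun t ht u hu => ?_⟩
      · rw [agreeStep hv2 t₁ t₂ ag u n2 n3 n4, a₁ u n2 n3 n4]
      · rcases Nat.le_succ_iff.1 ht with ht' | rfl
        · exact (t₂ u).1 (by rw [colour_eq, hu]) (o₁ t ht' u hu)
        · rwa [show u = v from Subtype.ext (hu.trans hv.symm)]
  obtain ⟨σ', t', ag, p, -, o⟩ := key K
  have filled : ColFilled σ' (j + 2) := by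
    intro u hu
    have hpar : rowParity K (u.1.1 - v₀.1.1) = 0 := by
      rw [map_sub, u.parity, v₀.parity, hu, hv₀, sub_self]
    rw [rowParity, ZMod.castHom_apply, ← ZMod.natCast_val, ZMod.natCast_eq_zero_iff] at hpar
    obtain ⟨t, ht⟩ := hpar
    have hlt := ZMod.val_lt (u.1.1 - v₀.1.1)
    refine o t (by omega) u (Prod.ext ?_ hu)
    have := ZMod.natCast_zmod_val (u.1.1 - v₀.1.1)
    rw [ht] at this
    push_cast at this
    rw [this]
    ring
  refine ⟨σ', t', filled, p, ?_⟩
  -- Only the triple column starting at `j + 2` changes, and it ends up full.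
  rw [← sum_colSum σ k, ← sum_colSum σ' k]
  refine Finset.sum_le_sum fun q hq => ?_
  have hqk := (Finset.mem_filter.1 hq).2
  by_cases hqj : q = j + 2
  · rw [hqj, filled.colSum_eq]
    exact colSum_le σ _
  · have same : ∀ a : ZMod (6 * L), a = 0 ∨ a = 1 ∨ a = 2 → ∀ i,
        occ σ' i (q + a) = occ σ i (q + a) := by
      intro a ha i
      have ne : ∀ d : ZMod (6 * L), d = 0 ∨ d = 1 ∨ d = 2 → q + a ≠ j + 2 + d := by
        intro d hd he
        have hc := congrArg (colColour L) he
        rw [map_add, map_add _ (j + 2), hqk, hk, add_left_cancel_iff] at hc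
        have had : a = d := by
          rcases ha with rfl | rfl | rfl <;> rcases hd with rfl | rfl | rfl <;>
            first
            | rfl
            | (exfalso
               simp only [map_zero, map_one, map_ofNat] at hc
               revert hc
               decide)
        rw [had] at he
        exact hqj (add_right_cancel he)
      refine occ_congr fun u hu => ?_
      have hu2 : u.1.2 = q + a := by rw [hu]
      refine ag u ?_ ?_ ?_
      · rw [hu2]
        simpa using ne 0 (.inl rfl)
      · rw [hu2, show j + 3 = j + 2 + 1 by ring]
        exact ne 1 (.inr (.inl rfl))
      · rw [hu2, show j + 4 = j + 2 + 2 by ring]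
        exact ne 2 (.inr (.inr rfl))
    refine le_of_eq (Finset.sum_congr rfl fun i _ => ?_)
    have s0 := same 0 (.inl rfl) i
    rw [add_zero] at s0
    rw [s0, same 1 (.inr (.inl rfl)) i, same 2 (.inr (.inr rfl)) i]

/-- Starting next to two empty columns, the colour of column `j + 2` can invade the grid column by
column. At most one particle at a time is lost, unless a full column of the next colour is met,
which costs a second one. -/
theorem reach_of_colEmpty {τ : Config K L} {j : ZMod (6 * L)} (h : ColEmpty τ j)
    (h' : ColEmpty τ (j + 1)) {b : ℕ} (hb : 1 ≤ b)
    (hb' : 2 ≤ b ∨ ∀ q, colColour L q = colColour L j → ¬ ColFilled τ q) :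
    Reach (count τ - b) τ (monochromatic K L (colColour L (j + 2))) := by
  set k := colColour L (j + 2) with hk
  have h3 : ∀ s : ℕ, colColour L (3 * s) = 0 := fun s => by
    rw [map_mul, map_ofNat, show (OfNat.ofNat 3 : ZMod 3) = 0 from rfl, zero_mul]
  have hkj : colColour L j ≠ k := by
    rw [hk, map_add, map_ofNat]
    generalize colColour L j = x; revert x; decide
  have key : ∀ s : ℕ, ∃ σ : Config K L, Towards k τ σ ∧ Reach (count τ - b) τ σ ∧
      count τ ≤ count σ ∧ (∀ t : ℕ, t < s → ColFilled σ (j + 2 + 3 * t)) ∧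
      ColEmpty σ (j + 3 * s) ∧ ColEmpty σ (j + 3 * s + 1) := by
    intro s
    induction s with
    | zero =>
      exact ⟨τ, .refl _ _, .refl _ _, le_rfl, fun t ht => absurd ht (Nat.not_lt_zero t),
        by simpa using h, by simpa using h'⟩
    | succ s ih =>
      obtain ⟨σ₁, t₁, p₁, c₁, f₁, o₁, o₁'⟩ := ih
      obtain ⟨σ₂, t₂, f₂, p₂, c₂⟩ := exists_colFilled o₁ o₁' hb (hb'.imp_right fun hq => by
        have hc : colColour L (j + 3 * s + 3) = colColour L j := by
          rw [map_add, map_add, h3, map_ofNat, show (OfNat.ofNat 3 : ZMod 3) = 0 from rfl,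
            add_zero, add_zero]
        have := hq _ hc
        unfold ColFilled at this
        push Not at this
        obtain ⟨u, hu, hu'⟩ := this
        exact ⟨u, hu, fun h1 => hu' ((t₁ u).2 (by rwa [colour_eq, hu, hc]) h1)⟩)
      rw [show colColour L (j + 3 * s + 2) = k by
        rw [add_right_comm, map_add, h3, add_zero]] at t₂
      refine ⟨σ₂, t₁.trans t₂, p₁.trans (p₂.mono (by omega)), c₁.trans c₂, fun t ht => ?_, ?_, ?_⟩
      · rcases Nat.lt_succ_iff_lt_or_eq.1 ht with ht' | rfl
        · intro u hu
          refine (t₂ u).1 ?_ (f₁ t ht' u hu)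
          rw [colour_eq, hu, map_add, h3, add_zero]
        · rwa [add_right_comm]
      · have := f₂.colEmpty_succ
        rwa [show j + 3 * s + 2 + 1 = j + 3 * ((s + 1 : ℕ) : ZMod (6 * L)) by
          push_cast; ring] at this
      · have := f₂.colEmpty_add_two
        rwa [show j + 3 * s + 2 + 2 = j + 3 * ((s + 1 : ℕ) : ZMod (6 * L)) + 1 by
          push_cast; ring] at this
  obtain ⟨σ, -, p, -, f, -, -⟩ := key (2 * L)
  rwa [← eq_monochromatic_of_forall_occupied (σ := σ) (k := k) fun u hu => ?_]
  have h0 : colColour L (u.1.2 - (j + 2)) = 0 := by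
    rw [map_sub, ← colour_eq, hu, hk, sub_self]
  rw [colColour, ZMod.castHom_apply, ← ZMod.natCast_val, ZMod.natCast_eq_zero_iff] at h0
  obtain ⟨t, ht⟩ := h0
  have hlt := ZMod.val_lt (u.1.2 - (j + 2))
  refine f t (by omega) u ?_
  have := ZMod.natCast_zmod_val (u.1.2 - (j + 2))
  rw [ht] at this
  push_cast at this
  rw [this]
  ring

/-! ### Reaching monochromatic configurations -/

/-- The double row `{r, r + 1}` is cleared and the rows are swept from there. -/
theorem reach_monochromatic_of_rowSum (σ : Config K L) (r : ZMod (2 * K)) (k : ZMod 3) :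
    Reach (count σ - (rowSum σ r + 1)) σ (monochromatic K L k) := by
  let τ := restrict σ fun u => u.1.1 ≠ r ∧ u.1.1 ≠ r + 1
  have hc : count σ ≤ count τ + rowSum σ r := by
    have e : rowSum σ r = ∑ i, ((if i = r then ∑ j, occ σ i j else 0) +
        if i = r + 1 then ∑ j, occ σ i j else 0) := by
      rw [Finset.sum_add_distrib, Finset.sum_ite_eq', Finset.sum_ite_eq', rowSum]
      simp [pairOcc, Finset.sum_add_distrib]
    rw [e, count_eq_sum_occ, count_eq_sum_occ, ← Finset.sum_add_distrib]
    refine Finset.sum_le_sum fun i _ => ?_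
    by_cases h1 : i = r
    · rw [if_pos h1]
      omega
    · by_cases h2 : i = r + 1
      · rw [if_pos h2]
        omega
      · exact Nat.le_add_right_of_le (Finset.sum_congr rfl fun j _ => occ_congr fun u hu =>
          (restrict_apply (by rw [hu]; exact ⟨h1, h2⟩)).symm).le
  have hτ : ∀ u, τ.1 u = 1 → σ.1 u = 1 := fun u hu => (restrict_eq_one_iff.1 hu).1
  refine ((reach_of_subset hτ).mono (by omega)).trans
    ((reach_of_rowOnly (r := r) (k := k) ?_ ?_).mono (by omega))
  · exact fun u hu hu' => absurd hu (restrict_eq_one_iff.1 hu').2.1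
  · exact fun u hu hu' => absurd hu (restrict_eq_one_iff.1 hu').2.2

/-- The columns `j` and `j + 1` are cleared and the columns are swept from there. -/
theorem reach_monochromatic_of_colSum (σ : Config K L) (j : ZMod (6 * L))
    (h : ∀ q, colColour L q = colColour L j → ¬ ColFilled σ q) :
    Reach (count σ - (colSum σ j + 1)) σ (monochromatic K L (colColour L (j + 2))) := by
  let τ := restrict σ fun u => u.1.2 ≠ j ∧ u.1.2 ≠ j + 1
  have hc : count σ ≤ count τ + colSum σ j := by
    have e : ∑ q, ((if q = j then ∑ i, occ σ i q else 0) +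
        if q = j + 1 then ∑ i, occ σ i q else 0) ≤ colSum σ j := by
      rw [Finset.sum_add_distrib, Finset.sum_ite_eq', Finset.sum_ite_eq', colSum]
      simp [Finset.sum_add_distrib]
    refine le_trans ?_ (Nat.add_le_add_left e _)
    rw [count_eq_sum_occ, count_eq_sum_occ, Finset.sum_comm,
      Finset.sum_comm (f := fun i j => occ τ i j), ← Finset.sum_add_distrib]
    refine Finset.sum_le_sum fun q _ => ?_
    by_cases h1 : q = j
    · rw [if_pos h1]
      omega
    · by_cases h2 : q = j + 1
      · rw [if_pos h2]
        omega
      · exact Nat.le_add_right_of_le (Finset.sum_congr rfl fun i _ => occ_congr fun u hu =>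
          (restrict_apply (by rw [hu]; exact ⟨h1, h2⟩)).symm).le
  have hτ : ∀ u, τ.1 u = 1 → σ.1 u = 1 := fun u hu => (restrict_eq_one_iff.1 hu).1
  refine ((reach_of_subset hτ).mono (by omega)).trans
    ((reach_of_colEmpty (j := j) (b := 1) ?_ ?_ le_rfl (.inr ?_)).mono (by omega))
  · exact fun u hu hu' => (restrict_eq_one_iff.1 hu').2.1 hu
  · exact fun u hu hu' => (restrict_eq_one_iff.1 hu').2.2 hu
  · exact fun q hq hf => h q hq fun u hu => hτ u (hf u hu)

theorem reach_monochromatic_succ (k : ZMod 3) :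
    Reach (2 * K * L - (min K (2 * L) + 1)) (monochromatic K L k)
      (monochromatic K L (k + 1)) := by
  rcases le_total K (2 * L) with h | h
  · obtain ⟨j, hj⟩ := exists_colColour (L := L) (k - 1)
    have := reach_monochromatic_of_colSum (monochromatic K L k) j (fun q hq hf => by
      obtain ⟨i, hi⟩ : ∃ i : ZMod (2 * K), rowParity K i = colParity L q := by
        have : ∀ y : ZMod 2, y = 0 ∨ y = 1 := by decide
        rcases this (colParity L q) with e | e
        · exact ⟨0, by rw [e, map_zero]⟩
        · exact ⟨1, by rw [e, map_one]⟩
      obtain ⟨u, hu⟩ := exists_site (K := K) (L := L) hi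
      have h1 := (monochromatic_apply k u).1 (hf u (by rw [hu]))
      rw [colour_eq, hu, hq, hj, sub_eq_self] at h1
      exact absurd h1 (by decide))
    rw [map_add, map_ofNat, hj, count_monochromatic, show k - 1 + OfNat.ofNat 2 = k + 1 by
      clear hj this; revert k; decide] at this
    have hle := colSum_le (monochromatic K L k) j
    exact this.mono (by omega)
  · have := reach_monochromatic_of_rowSum (monochromatic K L k) 0 (k + 1)
    rw [(fullRow_monochromatic k 0).rowSum_eq, count_monochromatic] at this
    exact this.mono (by omega)

theorem reach_monochromatic_of_ne {k k' : ZMod 3} (h : k ≠ k') :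
    Reach (2 * K * L - (min K (2 * L) + 1)) (monochromatic K L k) (monochromatic K L k') := by
  rcases zmod_three_cases h with rfl | rfl
  · exact reach_monochromatic_succ k
  · exact (reach_monochromatic_succ k').symm

/-- From a configuration that is not a ground state, one particle less has to be given up than
between ground states. If `2L ≤ K`, a double row that is not full is cleared. If `K ≤ 2L`, a full
column allows sweeping the columns without clearing anything, at the cost of two particles; if no
column is full, a triple column with fewer than `K` particles is cleared. -/
theorem exists_reach_monochromatic (hK : 2 ≤ K) {σ : Config K L} (h : count σ < 2 * K * L) :
    ∃ k, Reach (count σ - min K (2 * L)) σ (monochromatic K L k) := by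
  rcases le_total K (2 * L) with hKL | hKL
  · rw [min_eq_left hKL]
    by_cases hf : ∃ q, ColFilled σ q
    · obtain ⟨q, hq⟩ := hf
      refine ⟨_, (reach_of_colEmpty (b := 2) hq.colEmpty_succ ?_ (by norm_num)
        (.inl le_rfl)).mono (by omega)⟩
      rw [add_assoc, one_add_one_eq_two]
      exact hq.colEmpty_add_two
    · have : ∃ j, colSum σ j < K := by
        by_contra! hne
        have hs := Finset.card_nsmul_le_sum (Finset.univ.filter fun j => colColour L j = 0)
          (colSum σ) K fun j _ => hne j
        rw [sum_colSum, card_colour, smul_eq_mul] at hs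
        nlinarith
      obtain ⟨j, hj⟩ := this
      exact ⟨_, (reach_monochromatic_of_colSum σ j fun q _ hq => hf ⟨q, hq⟩).mono (by omega)⟩
  · rw [min_eq_right hKL]
    have : ∃ r, rowSum σ r < 2 * L := by
      by_contra! hne
      have hs := Finset.card_nsmul_le_sum Finset.univ (rowSum σ) (2 * L) fun r _ => hne r
      rw [sum_rowSum, Finset.card_univ, ZMod.card, smul_eq_mul] at hs
      nlinarith
    obtain ⟨r, hr⟩ := this
    exact ⟨0, (reach_monochromatic_of_rowSum σ r 0).mono (by omega)⟩

/-! ### Communication heights -/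

theorem commHeight_monochromatic (hK : 2 ≤ K) {k k' : ZMod 3} (h : k ≠ k') :
    (landscape K L).commHeight (monochromatic K L k) (monochromatic K L k') -
      (landscape K L).H (monochromatic K L k) = ((min K (2 * L) + 1 : ℕ) : ℝ) := by
  have hH : (landscape K L).H (monochromatic K L k) = -((2 * K * L : ℕ) : ℝ) := by
    change energy _ = _
    rw [energy_eq, count_monochromatic]
  have hm : min K (2 * L) + 1 ≤ 2 * K * L := by
    have h1 := min_le_left K (2 * L)
    have h2 : K * 1 ≤ K * L := Nat.mul_le_mul_left K (NeZero.one_le)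
    nlinarith
  rw [hH, sub_neg_eq_add, ← eq_sub_iff_add_eq]
  refine le_antisymm ?_ ?_
  · refine ((reach_monochromatic_of_ne h).commHeight_le
      (by rw [count_monochromatic]; omega)).trans (le_of_eq ?_)
    rw [Nat.cast_sub hm]
    ring
  · obtain ⟨ω, hω⟩ := ((landscape K L).isLeast_commHeight
      (exists_path (monochromatic K L k) (monochromatic K L k'))).1
    obtain ⟨i, hi⟩ := exists_count_lt_of_path hK h ω
    rw [← hω]
    refine le_trans ?_ (Finset.le_sup' (fun i => (landscape K L).H (ω.point i))
      (Finset.mem_univ i))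
    change _ ≤ energy (ω.point i)
    rw [energy_eq]
    have : ((count (ω.point i) + min K (2 * L) + 1 : ℕ) : ℝ) ≤ ((2 * K * L : ℕ) : ℝ) := by
      exact_mod_cast hi
    push_cast at this ⊢
    linarith

theorem mem_monochromatic_iff {σ : Config K L} :
    σ ∈ ({configA K L, configB K L, configC K L} : Set (Config K L)) ↔
      ∃ k, σ = monochromatic K L k := by
  have : ∀ k : ZMod 3, k = 0 ∨ k = 1 ∨ k = 2 := by decide
  constructor
  · rintro (rfl | rfl | rfl)
    exacts [⟨0, rfl⟩, ⟨1, rfl⟩, ⟨2, rfl⟩]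
  · rintro ⟨k, rfl⟩
    rcases this k with rfl | rfl | rfl
    exacts [.inl rfl, .inr (.inl rfl), .inr (.inr rfl)]

end

end TriangularGrid

theorem theorem3p1 (K L : ℕ) [NeZero K] [NeZero L] (hK : 2 ≤ K) :
    (landscape K L).stable = {configA K L, configB K L, configC K L} ∧
    ((landscape K L).commHeight (configA K L) (configB K L) - (landscape K L).H (configA K L)
        = ((min K (2 * L) + 1 : ℕ) : ℝ) ∧
      (landscape K L).commHeight (configA K L) (configC K L) - (landscape K L).H (configA K L)
        = ((min K (2 * L) + 1 : ℕ) : ℝ) ∧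
      (landscape K L).commHeight (configB K L) (configC K L) - (landscape K L).H (configB K L)
        = ((min K (2 * L) + 1 : ℕ) : ℝ)) ∧
    ∀ σ : Config K L, σ ∉ ({configA K L, configB K L, configC K L} : Set (Config K L)) →
      (landscape K L).commHeightSet {σ} {configA K L, configB K L, configC K L}
        - (landscape K L).H σ ≤ ((min K (2 * L) : ℕ) : ℝ) := by
  have hH : ∀ σ : Config K L, (landscape K L).H σ = -(count σ : ℝ) := energy_eq
  refine ⟨?_, ⟨commHeight_monochromatic hK (by decide), commHeight_monochromatic hK (by decide),
    commHeight_monochromatic hK (by decide)⟩, fun σ hσ => ?_⟩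
  · ext σ
    rw [mem_monochromatic_iff]
    constructor
    · intro h
      have := h (monochromatic K L 0)
      rw [hH, hH, neg_le_neg_iff, Nat.cast_le, count_monochromatic] at this
      exact exists_eq_monochromatic (le_antisymm (count_le σ) this)
    · rintro ⟨k, rfl⟩ η
      rw [hH, hH, neg_le_neg_iff, Nat.cast_le, count_monochromatic]
      exact count_le η
  · have hlt : count σ < 2 * K * L := lt_of_le_of_ne (count_le σ) fun h =>
      hσ (mem_monochromatic_iff.2 (exists_eq_monochromatic h))
    obtain ⟨k, hk⟩ := exists_reach_monochromatic hK hlt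
    have h1 := ((landscape K L).isLeast_commHeightSet (Set.singleton_nonempty σ)
      ⟨_, mem_monochromatic_iff.2 ⟨k, rfl⟩⟩).2
        (Set.mem_image2_of_mem (Set.mem_singleton σ) (mem_monochromatic_iff.2 ⟨k, rfl⟩))
    have h2 := hk.commHeight_le (Nat.sub_le _ _)
    have h3 : (count σ : ℝ) ≤ ((count σ - min K (2 * L) : ℕ) : ℝ) + ((min K (2 * L) : ℕ) : ℝ) := by
      exact_mod_cast (by omega : count σ ≤ count σ - min K (2 * L) + min K (2 * L))
    rw [hH]
    linarith
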